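/- Let $t\ge 1$, let $p_1,\dots,p_t$ be distinct primes with $p_i\equiv 1\pmod 4$ for $1\le i\le t-1$ and $p_t\equiv 3\pmod 4$, and put $\Delta=-p_1\cdots p_t$ and $F=\mathbb{Q}(\sqrt{\Delta})$. Let $\mathscr{C}$ be the class group of $F$, and for $k\ge1$ let $r_{2^k}=\dim_{\mathbb{F}_2}2^{k-1}\mathscr{C}/2^k\mathscr{C}$. Let $\xi\colon\{\pm1\}\to\mathbb{F}_2$ be the isomorphism of groups, and let $\mathfrak{p}_i$ be the prime ideal of $F$ with $\mathfrak{p}_i^2=(p_i)$. Let $V_0$ be the set of positive divisors $D$ of $p_1\cdots p_{t-1}$ such that the class of $\prod_{p_i\mid D}\mathfrak{p}_i$ lies in $2\mathscr{C}$; it is identified with $\mathscr{C}[2]\cap 2\mathscr{C}$ by sending $D$ to this class. For $E,D\in V_0$ put $$\mathfrak{B}(E,D)=\xi\Bigl(\prod_{p\mid D}\Bigl(\frac{N\mathfrak{b},\Delta}{p}\Bigr)\Bigr),$$ where $\mathfrak{b}$ is an integral ideal of $F$ such that $\mathfrak{b}^2$ lies in the ideal class corresponding to $E$ and $\bigl(\frac{\cdot,\cdot}{p}\bigr)$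 is the Hilbert symbol of $\mathbb{Q}_p$, and let $Q_{\mathfrak{B}}(D)=\mathfrak{B}(D,D)$ for $D\in V_0$. Then $Q_{\mathfrak{B}}$ is given by quartic residue symbols, $$Q_{\mathfrak{B}}(D)=\xi\Bigl(\Bigl(\frac{\Delta/D}{D}\Bigr)_4\Bigr)\quad\text{for all } D\in V_0,\qquad\text{where }\Bigl(\frac{a}{D}\Bigr)_4=\prod_{p\mid D}\Bigl(\frac{a}{p}\Bigr)_4,\quad \Bigl(\frac{a}{p}\Bigr)_4=\pm1\equiv a^{(p-1)/4}\pmod p,$$ and if $Q_{\mathfrak{B}}$ is identically zero on $V_0$, then $r_8\equiv r_4\pmod 2$. -/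

import Mathlib

open scoped NumberField nonZeroDivisors

noncomputable section

namespace EightRank

/-! ### The `2^k`-rank of an abelian group -/

/-- The quotient `2^(k-1) A / 2^k A` of an additive abelian group `A` (for `k ≥ 1`). -/
abbrev LayerQuot (A : Type*) [AddCommGroup A] (k : ℕ) : Type _ :=
  (nsmulAddMonoidHom (α := A) (2 ^ (k - 1))).range ⧸
    (nsmulAddMonoidHom (α := A) (2 ^ k)).range.addSubgroupOf
      (nsmulAddMonoidHom (α := A) (2 ^ (k - 1))).range

theorem two_nsmul_layerQuot (A : Type*) [AddCommGroup A] (k : ℕ) (hk : 1 ≤ k)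
    (x : LayerQuot A k) : 2 • x = 0 := by
  obtain ⟨⟨y, a, rfl⟩, rfl⟩ := QuotientAddGroup.mk_surjective x
  rw [← QuotientAddGroup.mk_nsmul, QuotientAddGroup.eq_zero_iff, AddSubgroup.mem_addSubgroupOf]
  refine ⟨a, ?_⟩
  obtain ⟨m, rfl⟩ := Nat.exists_eq_add_of_le' hk
  simp [pow_succ', mul_smul]

/-- The `2^k`-rank (`k ≥ 1`) of a commutative group `G`, written multiplicatively:
the dimension over `𝔽₂` of `2^(k-1) G / 2^k G` in additive notation. -/
def twoPowRank (G : Type*) [CommGroup G] (k : ℕ) (hk : 1 ≤ k) : ℕ :=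
  letI : Module (ZMod 2) (LayerQuot (Additive G) k) :=
    AddCommGroup.zmodModule (two_nsmul_layerQuot (Additive G) k hk)
  Module.finrank (ZMod 2) (LayerQuot (Additive G) k)

/-! ### Symbols -/

/-- The isomorphism `ξ : {±1} → 𝔽₂`. -/
def xi (u : ℤˣ) : ZMod 2 := if u = 1 then 0 else 1

open scoped Classical in
/-- The Hilbert symbol `(a, b / ℓ)` of `ℚ_ℓ` (for `a, b ≠ 0`): it is `1` if
`z² = a x² + b y²` has a nontrivial solution in `ℚ_ℓ`, and `-1` otherwise. -/
def hilbertSym (l : ℕ) [Fact l.Prime] (a b : ℚ_[l]) : ℤˣ :=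
  if ∃ x y z : ℚ_[l], (x ≠ 0 ∨ y ≠ 0 ∨ z ≠ 0) ∧ z ^ 2 = a * x ^ 2 + b * y ^ 2 then 1 else -1

/-- The symbol `(a, b / D) = ∏_{ℓ ∣ D} (a, b / ℓ)` for squarefree `D`. -/
def hilbertSymProd (D : ℕ) (a b : ℤ) : ℤˣ :=
  ∏ l ∈ D.primeFactors.attach,
    haveI : Fact (l : ℕ).Prime := ⟨Nat.prime_of_mem_primeFactors l.2⟩
    hilbertSym (l : ℕ) (a : ℚ_[(l : ℕ)]) (b : ℚ_[(l : ℕ)])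

/-- The rational quartic residue symbol `(a / ℓ)₄ = ±1 ≡ a ^ ((ℓ - 1) / 4) (mod ℓ)`, for a prime
`ℓ ≡ 1 (mod 4)` and a quadratic residue `a` prime to `ℓ`. -/
def quarticSym (a : ℤ) (l : ℕ) : ℤˣ :=
  if (a : ZMod l) ^ ((l - 1) / 4) = 1 then 1 else -1

/-- The symbol `(a / D)₄ = ∏_{ℓ ∣ D} (a / ℓ)₄` for squarefree `D`. -/
def quarticSymProd (a : ℤ) (D : ℕ) : ℤˣ := ∏ l ∈ D.primeFactors, quarticSym a l

/-! ### The forms `𝔅` and `Q_𝔅`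

The primes are `p 0, …, p n`, so that `t = n + 1` and `p n` is the last prime `p_t`. -/

/-- `Δ = - p₁ ⋯ p_t`. -/
def disc {n : ℕ} (p : Fin (n + 1) → ℕ) : ℤ := -∏ i, (p i : ℤ)

variable (F : Type*) [Field F] [NumberField F] {n : ℕ} (p : Fin (n + 1) → ℕ)

/-- `𝔞` is the ideal with `𝔞² = (D)`. For `D = ∏ pᵢ` this is `∏ 𝔭ᵢ`, where `𝔭ᵢ² = (pᵢ)`. -/
def IsRootIdeal (D : ℕ) (𝔞 : (Ideal (𝓞 F))⁰) : Prop :=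
  (𝔞 : Ideal (𝓞 F)) ^ 2 = Ideal.span {(D : 𝓞 F)}

/-- `V₀ = 𝒞[2] ∩ 2𝒞`, as a set of positive divisors `D` of `p₁ ⋯ p_{t-1}`: the divisor `∏ pᵢ` is
identified with the class of `∏ 𝔭ᵢ` in `𝒞[2]`, and this class must be a square in `𝒞`. -/
def V₀ : Set ℕ :=
  {D | D ∣ ∏ i : Fin n, p i.castSucc ∧
    ∃ 𝔞 : (Ideal (𝓞 F))⁰, IsRootIdeal F D 𝔞 ∧ ∃ c : ClassGroup (𝓞 F), c ^ 2 = ClassGroup.mk0 𝔞}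

theorem exists_sqrtIdeal (D : V₀ F p) :
    ∃ 𝔟 : (Ideal (𝓞 F))⁰, ∃ 𝔞 : (Ideal (𝓞 F))⁰, IsRootIdeal F D 𝔞 ∧
      ClassGroup.mk0 𝔟 ^ 2 = ClassGroup.mk0 𝔞 := by
  obtain ⟨-, 𝔞, h𝔞, c, hc⟩ := D.2
  obtain ⟨𝔟, rfl⟩ := ClassGroup.mk0_surjective c
  exact ⟨𝔟, 𝔞, h𝔞, hc⟩

/-- An ideal `𝔟` such that the class of `𝔟²` is the element of `V₀` given by `D`. -/
def sqrtIdeal (D : V₀ F p) : (Ideal (𝓞 F))⁰ := (exists_sqrtIdeal F p D).choose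

/-- `χ_D(𝔟) = (N𝔟, Δ / D)`. -/
def chi (D : ℕ) (𝔟 : (Ideal (𝓞 F))⁰) : ℤˣ :=
  hilbertSymProd D (Ideal.absNorm (𝔟 : Ideal (𝓞 F)) : ℤ) (disc p)

/-- The form `𝔅(E, D) = ξ(χ_D(𝔟))` on `V₀`, where `𝔟` is a square root of the class of `E`. -/
def formB (E D : V₀ F p) : ZMod 2 := xi (chi F p D (sqrtIdeal F p E))

/-- The quadratic form `Q_𝔅(D) = 𝔅(D, D)`. -/
def formQ (D : V₀ F p) : ZMod 2 := formB F p D D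

end EightRank

end

noncomputable section

namespace EightRank

/-! ### Alternating forms and ranks of finite abelian groups -/

/-! Write `A` additively for the class group and put `n = t - 1`. Genus theory gives two maps. The
Hilbert symbols of ideal norms at the primes `≡ 1 (mod 4)` form a homomorphism `χ : A → 𝔽₂ⁿ`,
surjective by Dirichlet's theorem (`exists_genusChar_eq`). The ramified primes give `ρ : 𝔽₂ⁿ → A`
with image `A[2]` (`exists_rootHom`, `exists_divisorOf_isRootIdeal`). Counting then forces `ker χ =
2A` and `ρ` injective.

By quadratic reciprocity the map `T = χ ∘ ρ` is symmetric. Its kernel `V` is `A[2] ∩ 2A`, of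
dimension `r₄`, and on it `𝔅(v, w) = χ(b) · w` with `2b = ρ v`. Symmetry of `T` makes this
independent of `b`; since the range of `T` is the orthogonal complement of `V`, it also makes the
kernel of `𝔅` equal to `A[2] ∩ 4A`, of dimension `r₈`. If `Q_𝔅 = 0` then `𝔅` is alternating, so its
rank `r₄ - r₈` is even (`twoPowRank_three_modEq_two`).

For the quartic formula, take `𝔟` primitive of norm `N` prime to `2Δ`, with `𝔟²𝔞 = (β)` and `𝔞² =
(D)`. The norm of `β` yields `4N² = D z² - e y²` with `e = Δ/D`. Raising this to the power `(q-1)/4`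
modulo a prime `q ∣ D` gives `(e/q)₄ = (N/q)(y/q)` (`quarticSym_eq_of_dvd`). The product of the
`(N/q)` is `χ_D(𝔟)`, and `(y/D) = 1` (`jacobiSym_eq_one_of_eq`). -/

theorem finrank_modEq_finrank_ker_of_alternating {K : Type*} [Field K] (d : ℕ) :
    ∀ {V : Type _} [AddCommGroup V] [Module K V] [FiniteDimensional K V]
      (B : V →ₗ[K] V →ₗ[K] K), (∀ v, B v v = 0) → Module.finrank K V = d →
      Module.finrank K V ≡ Module.finrank K (LinearMap.ker B) [MOD 2] := by
  induction d using Nat.strong_induction_on with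
  | _ d ih =>
    intro V _ _ _ B hB hd
    have hskew : ∀ u v, B u v = -B v u := by
      intro u v
      have h := hB (u + v)
      simp only [map_add, LinearMap.add_apply, hB, zero_add, add_zero] at h
      exact eq_neg_of_add_eq_zero_right h
    by_cases h0 : B = 0
    · subst h0
      rw [LinearMap.ker_zero, finrank_top]
    obtain ⟨x, y, hxy⟩ : ∃ x y, B x y ≠ 0 := by
      by_contra! h
      exact h0 (LinearMap.ext fun x => LinearMap.ext fun y => by simpa using h x y)
    have hyx : B y x ≠ 0 := by rw [hskew]; exact neg_ne_zero.mpr hxy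
    let f : V →ₗ[K] K × K := (B x).prod (B y)
    have hf : Function.Surjective f := by
      rintro ⟨a, b⟩
      refine ⟨(a / B x y) • y + (b / B y x) • x, ?_⟩
      simp [f, hB, hxy, hyx]
    -- The vectors `x, y` span a nondegenerate plane, and `W` is its orthogonal complement. Passing
    -- to `W` lowers the dimension by two and leaves the kernel of the form unchanged.
    let W := LinearMap.ker f
    have hW : Module.finrank K W + 2 = Module.finrank K V := by
      have h := LinearMap.finrank_range_add_finrank_ker f
      rw [LinearMap.range_eq_top.mpr hf, finrank_top, Module.finrank_prod, Module.finrank_self] at h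
      change Module.finrank K (LinearMap.ker f) + 2 = _
      omega
    have hxW : ∀ w ∈ W, B w x = 0 ∧ B w y = 0 := by
      intro w hw
      have h : B x w = 0 ∧ B y w = 0 := by simpa [W, f] using hw
      rw [hskew w x, hskew w y, h.1, h.2]
      simp
    let B' : W →ₗ[K] W →ₗ[K] K := B.domRestrict₁₂ W W
    have hB' := ih (Module.finrank K W) (by omega) B' (fun v => hB v) rfl
    have hker : (LinearMap.ker B').map W.subtype = LinearMap.ker B := by
      ext v
      simp only [Submodule.mem_map, LinearMap.mem_ker]
      constructor
      · rintro ⟨w, hw, rfl⟩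
        refine LinearMap.ext fun z => ?_
        have hz : z - ((B x z / B x y) • y + (B y z / B y x) • x) ∈ W := by
          simp [W, f, hB, hxy, hyx]
        have h1 : B w (z - ((B x z / B x y) • y + (B y z / B y x) • x)) = 0 :=
          LinearMap.congr_fun hw ⟨_, hz⟩
        have h2 := hxW w w.2
        simpa [h2.1, h2.2] using h1
      · intro hv
        refine ⟨⟨v, ?_⟩, ?_, rfl⟩
        · have : B x v = 0 ∧ B y v = 0 := by rw [hskew x v, hskew y v, hv]; simp
          simpa [W, f] using this
        · exact LinearMap.ext fun z => LinearMap.congr_fun hv z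
    have hk : Module.finrank K (LinearMap.ker B') = Module.finrank K (LinearMap.ker B) := by
      rw [← hker]
      exact (LinearEquiv.finrank_eq
        (Submodule.equivMapOfInjective W.subtype W.injective_subtype _))
    rw [← hk, ← hW]
    exact (Nat.add_modEq_right).trans hB'

/-- Doubling maps `2^(k-1) A` onto `2^k A` with kernel `A[2] ∩ 2^(k-1) A`, so this kernel has the
order of the quotient. The ranks thus become sizes of subgroups of `A[2]`. -/
theorem card_layerQuot {A : Type*} [AddCommGroup A] [Finite A] (k : ℕ) (hk : 1 ≤ k) :
    Nat.card (LayerQuot A k) = Nat.card {a : A // 2 • a = 0 ∧ ∃ b : A, 2 ^ (k - 1) • b = a} := by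
  obtain ⟨m, rfl⟩ := Nat.exists_eq_add_of_le' hk
  set R := (nsmulAddMonoidHom (α := A) (2 ^ (m + 1 - 1))).range with hR
  let g : R →+ A := (nsmulAddMonoidHom 2).comp R.subtype
  have hrange : g.range = (nsmulAddMonoidHom (α := A) (2 ^ (m + 1))).range := by
    ext a
    simp only [AddMonoidHom.mem_range]
    constructor
    · rintro ⟨⟨_, b, rfl⟩, rfl⟩
      exact ⟨b, by simp [g, pow_succ', mul_smul]⟩
    · rintro ⟨b, rfl⟩
      exact ⟨⟨_, b, rfl⟩, by simp [g, pow_succ', mul_smul]⟩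
  have hle : (nsmulAddMonoidHom (α := A) (2 ^ (m + 1))).range ≤ R := by
    rintro _ ⟨b, rfl⟩
    exact ⟨2 • b, by simp [pow_succ, mul_smul]⟩
  have h1 : Nat.card R = Nat.card (LayerQuot A (m + 1)) *
      Nat.card (nsmulAddMonoidHom (α := A) (2 ^ (m + 1))).range := by
    rw [AddSubgroup.card_eq_card_quotient_mul_card_addSubgroup
      ((nsmulAddMonoidHom (α := A) (2 ^ (m + 1))).range.addSubgroupOf R)]
    rw [Nat.card_congr (AddSubgroup.addSubgroupOfEquivOfLe hle).toEquiv]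
  have h2 : Nat.card R = Nat.card g.range * Nat.card g.ker := by
    rw [AddSubgroup.card_eq_card_quotient_mul_card_addSubgroup g.ker]
    rw [Nat.card_congr (QuotientAddGroup.quotientKerEquivRange g).toEquiv]
  have h3 : Nat.card g.ker =
      Nat.card {a : A // 2 • a = 0 ∧ ∃ b : A, 2 ^ (m + 1 - 1) • b = a} := by
    refine Nat.card_congr ⟨fun a => ⟨a.1.1, a.2, a.1.2⟩, fun a => ⟨⟨a.1, a.2.2⟩, a.2.1⟩,
      fun _ => rfl, fun _ => rfl⟩
  rw [hrange] at h2
  rw [← h3]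
  have hpos : 0 < Nat.card (nsmulAddMonoidHom (α := A) (2 ^ (m + 1))).range := Nat.card_pos
  refine Nat.eq_of_mul_eq_mul_right hpos ?_
  rw [← h1, h2, mul_comm]

theorem two_pow_twoPowRank {G : Type*} [CommGroup G] [Finite G] (k : ℕ) (hk : 1 ≤ k) :
    2 ^ twoPowRank G k hk = Nat.card {a : Additive G // 2 • a = 0 ∧
      ∃ b : Additive G, 2 ^ (k - 1) • b = a} := by
  rw [← card_layerQuot k hk]
  let _ : Module (ZMod 2) (LayerQuot (Additive G) k) :=
    AddCommGroup.zmodModule (two_nsmul_layerQuot (Additive G) k hk)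
  have h := Module.natCard_eq_pow_finrank (K := ZMod 2) (V := LayerQuot (Additive G) k)
  rw [Nat.card_zmod] at h
  exact h.symm

theorem finrank_eq_of_card_eq_two_pow {V : Type*} [AddCommGroup V] [Module (ZMod 2) V] [Finite V]
    {r : ℕ} (h : 2 ^ r = Nat.card V) : Module.finrank (ZMod 2) V = r := by
  have h' := Module.natCard_eq_pow_finrank (K := ZMod 2) (V := V)
  rw [Nat.card_zmod, ← h] at h'
  exact (Nat.pow_right_injective le_rfl h').symm

/-! ### Counting in a finite abelian group with maps `χ` and `ρ`. -/

section Abstract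

variable {A : Type*} [AddCommGroup A] {n : ℕ}

theorem two_nsmul_pi_zmod_two (u : Fin n → ZMod 2) : 2 • u = 0 := by
  rw [two_nsmul]
  exact funext fun i => CharTwo.add_self_eq_zero (u i)

theorem card_two_torsion_mul_card_two_range :
    Nat.card (nsmulAddMonoidHom (α := A) 2).range * Nat.card (nsmulAddMonoidHom (α := A) 2).ker =
      Nat.card A := by
  rw [AddSubgroup.card_eq_card_quotient_mul_card_addSubgroup (nsmulAddMonoidHom (α := A) 2).ker,
    Nat.card_congr (QuotientAddGroup.quotientKerEquivRange (nsmulAddMonoidHom (α := A) 2)).toEquiv]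

theorem card_ker_mul_two_pow (χ : A →+ (Fin n → ZMod 2)) (hχ : Function.Surjective χ) :
    2 ^ n * Nat.card χ.ker = Nat.card A := by
  rw [AddSubgroup.card_eq_card_quotient_mul_card_addSubgroup χ.ker,
    Nat.card_congr (QuotientAddGroup.quotientKerEquivOfSurjective χ hχ).toEquiv]
  simp

theorem two_range_le_ker (χ : A →+ (Fin n → ZMod 2)) :
    (nsmulAddMonoidHom (α := A) 2).range ≤ χ.ker := by
  rintro _ ⟨b, rfl⟩
  rw [AddMonoidHom.mem_ker]
  exact (map_nsmul χ 2 b).trans (two_nsmul_pi_zmod_two _)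

theorem card_two_torsion_le (ρ : (Fin n → ZMod 2) →+ A)
    (hρ : ∀ a : A, 2 • a = 0 → ∃ u, ρ u = a) :
    Nat.card (nsmulAddMonoidHom (α := A) 2).ker ≤ 2 ^ n := by
  have h : Nat.card (Fin n → ZMod 2) = 2 ^ n := by simp
  rw [← h]
  have hmem : ∀ u, ρ u ∈ (nsmulAddMonoidHom (α := A) 2).ker := by
    intro u
    exact (map_nsmul ρ 2 u).symm.trans (by rw [two_nsmul_pi_zmod_two, map_zero])
  refine Nat.card_le_card_of_surjective (fun u => ⟨ρ u, hmem u⟩) ?_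
  rintro ⟨a, ha⟩
  obtain ⟨u, rfl⟩ := hρ a ha
  exact ⟨u, rfl⟩

/-- Both `|2A| · |A[2]|` and `2ⁿ · |ker χ|` equal `|A|`. Since `|A[2]| ≤ 2ⁿ`, the inclusion `2A ⊆
ker χ` is an equality. -/
theorem exists_two_nsmul_eq_of_mem_ker [Finite A] (χ : A →+ (Fin n → ZMod 2)) (hχ : Function.Surjective χ)
    (ρ : (Fin n → ZMod 2) →+ A) (hρ : ∀ a : A, 2 • a = 0 → ∃ u, ρ u = a)
    {a : A} (ha : χ a = 0) : ∃ b, 2 • b = a := by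
  have h1 := card_two_torsion_mul_card_two_range (A := A)
  have h2 := card_ker_mul_two_pow χ hχ
  have h3 := card_two_torsion_le ρ hρ
  have h4 : Nat.card χ.ker ≤ Nat.card (nsmulAddMonoidHom (α := A) 2).range := by
    refine le_of_mul_le_mul_left (a := 2 ^ n) ?_ (by norm_num)
    rw [h2, ← h1, mul_comm]
    exact Nat.mul_le_mul_right _ h3
  have h5 := AddSubgroup.eq_of_le_of_card_ge (two_range_le_ker χ) h4
  have : a ∈ (nsmulAddMonoidHom (α := A) 2).range := by rw [h5]; exact ha
  exact this

/-- The same two factorizations of `|A|`, read with `2A ⊆ ker χ`, give `|A[2]| ≥ 2ⁿ`, so a map from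
`𝔽₂ⁿ` covering `A[2]` has trivial kernel. -/
theorem injective_of_surjective_two_torsion [Finite A] (χ : A →+ (Fin n → ZMod 2))
    (hχ : Function.Surjective χ) (ρ : (Fin n → ZMod 2) →+ A)
    (hρ : ∀ a : A, 2 • a = 0 → ∃ u, ρ u = a) : Function.Injective ρ := by
  have h1 := card_two_torsion_mul_card_two_range (A := A)
  have h2 := card_ker_mul_two_pow χ hχ
  have h3 : Nat.card (nsmulAddMonoidHom (α := A) 2).range ≤ Nat.card χ.ker :=
    Nat.card_le_card_of_injective _ (AddSubgroup.inclusion_injective (two_range_le_ker χ))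
  have h4 : 2 ^ n ≤ Nat.card (nsmulAddMonoidHom (α := A) 2).ker := by
    refine Nat.le_of_mul_le_mul_right (c := Nat.card χ.ker) ?_ Nat.card_pos
    rw [h2, ← h1, mul_comm]
    exact Nat.mul_le_mul_left _ h3
  have h5 : Nat.card (nsmulAddMonoidHom (α := A) 2).ker ≤ Nat.card ρ.range :=
    Nat.card_le_card_of_injective (fun a => ⟨a.1, hρ a.1 a.2⟩)
      (fun a b h => by
        have h' := congrArg Subtype.val h
        exact Subtype.ext h')
  have h6 : Nat.card (Fin n → ZMod 2) = Nat.card ρ.range * Nat.card ρ.ker := by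
    rw [AddSubgroup.card_eq_card_quotient_mul_card_addSubgroup ρ.ker,
      Nat.card_congr (QuotientAddGroup.quotientKerEquivRange ρ).toEquiv]
  have h7 : Nat.card (Fin n → ZMod 2) = 2 ^ n := by simp
  rw [← AddMonoidHom.ker_eq_bot_iff, ← AddSubgroup.card_eq_one]
  have h8 : 0 < Nat.card ρ.ker := Nat.card_pos
  have h9 : 0 < 2 ^ n := by positivity
  nlinarith

/-- A functional separating `w` from the range of `T` is the dot product with some `v`. By symmetry
`T v` is orthogonal to everything, hence zero, and the hypothesis at `v` contradicts the separation.
-/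
theorem mem_range_of_forall_ker_dotProduct_eq_zero
    (T : (Fin n → ZMod 2) →ₗ[ZMod 2] (Fin n → ZMod 2)) (hT : ∀ u v, T u ⬝ᵥ v = T v ⬝ᵥ u)
    {w : Fin n → ZMod 2} (hw : ∀ v, T v = 0 → w ⬝ᵥ v = 0) : ∃ u, T u = w := by
  by_contra hne
  obtain ⟨φ, hφ, hle⟩ := Submodule.exists_le_ker_of_notMem (p := LinearMap.range T) (v := w) hne
  set v : Fin n → ZMod 2 := fun i => φ (Pi.single i 1) with hv
  have hdot : ∀ u, φ u = u ⬝ᵥ v := by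
    intro u
    rw [LinearMap.pi_apply_eq_sum_univ φ u]
    simp only [smul_eq_mul, hv, dotProduct]
    refine Finset.sum_congr rfl fun i _ => ?_
    congr 2
    ext j
    rw [Pi.single_apply]
    exact if_congr eq_comm rfl rfl
  refine hφ ?_
  rw [hdot]
  refine hw v ?_
  refine dotProduct_eq_zero _ fun u => ?_
  rw [hT, ← hdot]
  exact hle ⟨u, rfl⟩

end Abstract

theorem twoPowRank_three_modEq_two {G : Type*} [CommGroup G] [Finite G] {n : ℕ}
    (χ : Additive G →+ (Fin n → ZMod 2)) (hχ : Function.Surjective χ)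
    (ρ : (Fin n → ZMod 2) →+ Additive G) (hρ : ∀ a, 2 • a = 0 → ∃ u, ρ u = a)
    (hsymm : ∀ u v, χ (ρ u) ⬝ᵥ v = χ (ρ v) ⬝ᵥ u)
    (halt : ∀ u b, 2 • b = ρ u → χ b ⬝ᵥ u = 0) :
    twoPowRank G 3 (by norm_num) ≡ twoPowRank G 2 (by norm_num) [MOD 2] := by
  have hinj := injective_of_surjective_two_torsion χ hχ ρ hρ
  let T : (Fin n → ZMod 2) →ₗ[ZMod 2] (Fin n → ZMod 2) := (χ.comp ρ).toZModLinearMap 2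
  have hT : ∀ u, T u = χ (ρ u) := fun _ => rfl
  let V := LinearMap.ker T
  have hρ2 : ∀ u, 2 • ρ u = 0 := fun u => by rw [← map_nsmul, two_nsmul_pi_zmod_two, map_zero]
  have hsq : ∀ v : V, ∃ b, 2 • b = ρ v := fun v =>
    exists_two_nsmul_eq_of_mem_ker χ hχ ρ hρ v.2
  choose b hb using hsq
  -- Two choices of `b` differ by an element of `A[2]`, which is some `ρ u`; symmetry moves `T` onto
  -- `v ∈ ker T`. So the form below does not depend on the choice.
  have hwd : ∀ (c : Additive G) (v : V), 2 • c = 0 → χ c ⬝ᵥ (v : Fin n → ZMod 2) = 0 := by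
    intro c v hc
    obtain ⟨u, rfl⟩ := hρ c hc
    rw [hsymm, ← hT, LinearMap.mem_ker.mp v.2, zero_dotProduct]
  let f₀ : V →+ (V →ₗ[ZMod 2] ZMod 2) :=
    AddMonoidHom.mk' (fun v => (dotProductBilin (ZMod 2) (ZMod 2) (χ (b v))).comp V.subtype) (by
      intro v v'
      refine LinearMap.ext fun w => ?_
      have h : 2 • (b (v + v') - b v - b v') = 0 := by
        rw [smul_sub, smul_sub, hb, hb, hb]
        simp
      have h' := hwd _ w h
      rw [map_sub, map_sub, sub_dotProduct, sub_dotProduct, sub_sub, sub_eq_zero] at h'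
      exact h')
  let f : V →ₗ[ZMod 2] V →ₗ[ZMod 2] ZMod 2 := f₀.toZModLinearMap 2
  have hf : ∀ v w, f v w = χ (b v) ⬝ᵥ (w : Fin n → ZMod 2) := fun _ _ => rfl
  have hmod := finrank_modEq_finrank_ker_of_alternating _ f
    (fun v => by rw [hf]; exact halt _ _ (hb v)) rfl
  have hχ2 : ∀ a, χ (2 • a) = 0 := fun a => by rw [map_nsmul, two_nsmul_pi_zmod_two]
  have hV : Module.finrank (ZMod 2) V = twoPowRank G 2 (by norm_num) := by
    refine finrank_eq_of_card_eq_two_pow ?_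
    rw [two_pow_twoPowRank]
    refine (Nat.card_congr (Equiv.ofBijective
      (fun v : V => ⟨ρ v, hρ2 _, b v, by simpa using hb v⟩) ⟨?_, ?_⟩)).symm
    · intro v w h
      exact Subtype.ext (hinj (congrArg Subtype.val h))
    · rintro ⟨a, ha, c, hc⟩
      obtain ⟨u, rfl⟩ := hρ a ha
      refine ⟨⟨u, ?_⟩, rfl⟩
      rw [LinearMap.mem_ker, hT, ← hc]
      simpa using hχ2 c
  -- If `f v = 0` then `χ (b v)` is orthogonal to `ker T`, so it equals `T u` for some `u`. Hence `b
  -- v - ρ u` lies in `ker χ = 2A`, and doubling gives `ρ v ∈ 4A`.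
  have hkermem : ∀ v : V, f v = 0 ↔ ∃ c, 2 ^ (3 - 1) • c = ρ v := by
    intro v
    have h4 : ∀ c : Additive G, 2 ^ (3 - 1) • c = 2 • 2 • c := fun c => by
      rw [← mul_smul]; norm_num
    constructor
    · intro hv
      obtain ⟨u, hu⟩ := mem_range_of_forall_ker_dotProduct_eq_zero T hsymm (w := χ (b v))
        (fun w hw => by
          have := LinearMap.congr_fun hv ⟨w, hw⟩
          rwa [hf] at this)
      obtain ⟨c, hc⟩ := exists_two_nsmul_eq_of_mem_ker χ hχ ρ hρ (a := b v - ρ u)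
        (by rw [map_sub, ← hT, hu, sub_self])
      refine ⟨c, ?_⟩
      rw [h4, hc, smul_sub, hρ2, hb, sub_zero]
    · rintro ⟨c, hc⟩
      refine LinearMap.ext fun w => ?_
      rw [h4] at hc
      have h := hwd (b v - 2 • c) w (by rw [smul_sub, hb, hc, sub_self])
      rw [map_sub, hχ2, sub_zero] at h
      rw [hf, h]
      rfl
  have hker : Module.finrank (ZMod 2) (LinearMap.ker f) = twoPowRank G 3 (by norm_num) := by
    refine finrank_eq_of_card_eq_two_pow ?_
    rw [two_pow_twoPowRank]
    refine (Nat.card_congr (Equiv.ofBijective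
      (fun v : LinearMap.ker f => ⟨ρ v.1, hρ2 _, (hkermem v.1).mp v.2⟩) ⟨?_, ?_⟩)).symm
    · intro v w h
      exact Subtype.ext (Subtype.ext (hinj (congrArg Subtype.val h)))
    · rintro ⟨a, ha, c, hc⟩
      obtain ⟨u, rfl⟩ := hρ a ha
      have hu : u ∈ V := by
        rw [LinearMap.mem_ker, hT, ← hc, show 2 ^ (3 - 1) • c = 2 • 2 • c by
          rw [← mul_smul]; norm_num]
        exact hχ2 _
      exact ⟨⟨⟨u, hu⟩, (hkermem ⟨u, hu⟩).mpr ⟨c, hc⟩⟩, rfl⟩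
  rw [← hV, ← hker]
  exact hmod.symm

/-! ### Hilbert symbols at odd primes -/

/-- `a` is a value of the binary form `x² - d y²`. -/
def IsNormValue {K : Type*} [Field K] (d a : K) : Prop := ∃ x y : K, a = x ^ 2 - d * y ^ 2

namespace IsNormValue

variable {K : Type*} [Field K] {d a b : K}

theorem mul (ha : IsNormValue d a) (hb : IsNormValue d b) : IsNormValue d (a * b) := by
  obtain ⟨x, y, rfl⟩ := ha
  obtain ⟨z, w, rfl⟩ := hb
  exact ⟨x * z + d * y * w, x * w + y * z, by ring⟩

theorem sq (d c : K) : IsNormValue d (c ^ 2) := ⟨c, 0, by ring⟩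

theorem neg_self (d : K) : IsNormValue d (-d) := ⟨0, 1, by ring⟩

theorem of_mul_left (h : IsNormValue d (a * b)) (ha : IsNormValue d a) (ha0 : a ≠ 0) :
    IsNormValue d b := by
  have := (h.mul ha).mul (sq d a⁻¹)
  convert this using 1
  field_simp

theorem inv (ha : IsNormValue d a) : IsNormValue d a⁻¹ := by
  by_cases h : a = 0
  · simpa [h] using sq d (0 : K)
  · refine of_mul_left (a := a) ?_ ha h
    rw [mul_inv_cancel₀ h]
    simpa using sq d (1 : K)

theorem pow (ha : IsNormValue d a) (k : ℕ) : IsNormValue d (a ^ k) := by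
  induction k with
  | zero => simpa using sq d (1 : K)
  | succ k ih => rw [pow_succ]; exact ih.mul ha

theorem zpow (ha : IsNormValue d a) (k : ℤ) : IsNormValue d (a ^ k) := by
  cases k with
  | ofNat k => simpa using ha.pow k
  | negSucc k => rw [zpow_negSucc]; exact (ha.pow _).inv

end IsNormValue

theorem hilbertSym_eq_one_iff {l : ℕ} [Fact l.Prime] {a d : ℚ_[l]} (ha : a ≠ 0) (hd : d ≠ 0) :
    hilbertSym l a d = 1 ↔ IsNormValue d a := by
  have key : (∃ x y z : ℚ_[l], (x ≠ 0 ∨ y ≠ 0 ∨ z ≠ 0) ∧ z ^ 2 = a * x ^ 2 + d * y ^ 2) ↔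
      IsNormValue d a := by
    constructor
    · rintro ⟨x, y, z, hne, h⟩
      by_cases hx : x = 0
      · subst hx
        have hy : y ≠ 0 := by
          rintro rfl
          have : z = 0 := by simpa using h
          simp [this] at hne
        have hz : d = (z / y) ^ 2 := by
          field_simp
          linear_combination -h
        have hz0 : z ≠ 0 := by
          rintro rfl
          simp [hz] at hd
        -- Here `d` is a nonzero square, so the form splits into two linear factors; they are given
        -- the values `a` and `1`.
        refine ⟨(a + 1) / 2, (a - 1) / (2 * (z / y)), ?_⟩
        rw [hz]
        field_simp
        ring
      · refine ⟨z / x, y / x, ?_⟩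
        field_simp
        linear_combination -h
    · rintro ⟨x, y, rfl⟩
      exact ⟨1, y, x, by simp, by ring⟩
  unfold hilbertSym
  split_ifs with h
  · simpa using key.mp h
  · simpa using fun h' => h (key.mpr h')

/-- Hensel's lemma for `X² - w` at a lift `a` of the root modulo `l`: the derivative `2a` is a unit
because `l` is odd. -/
theorem isSquare_of_isSquare_toZMod {l : ℕ} [Fact l.Prime] (hl : l ≠ 2) {w : ℤ_[l]}
    (hw : ‖w‖ = 1) (h : IsSquare (PadicInt.toZMod w)) : ∃ z : ℤ_[l], z ^ 2 = w := by
  obtain ⟨r, hr⟩ := h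
  obtain ⟨a, rfl⟩ := ZMod.ringHom_surjective (PadicInt.toZMod : ℤ_[l] →+* ZMod l) r
  have hker : ∀ x : ℤ_[l], ‖x‖ < 1 ↔ PadicInt.toZMod x = 0 := fun x => by
    rw [← RingHom.mem_ker, PadicInt.ker_toZMod, IsLocalRing.mem_maximalIdeal,
      PadicInt.mem_nonunits]
  have hunit : ∀ x : ℤ_[l], PadicInt.toZMod x ≠ 0 → ‖x‖ = 1 := fun x hx =>
    le_antisymm (PadicInt.norm_le_one x) (not_lt.mp fun h => hx ((hker x).mp h))
  have hw0 : PadicInt.toZMod w ≠ 0 := fun h => by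
    have := (hker w).mpr h
    rw [hw] at this
    exact lt_irrefl _ this
  have ha0 : PadicInt.toZMod a ≠ 0 := fun h => hw0 (by rw [hr, h, mul_zero])
  have h2 : (2 : ZMod l) ≠ 0 := by
    have := ZMod.prime_ne_zero l 2 hl
    simpa using this
  have hder : ‖(2 * a : ℤ_[l])‖ = 1 := hunit _ (by
    rw [map_mul, map_ofNat]
    exact mul_ne_zero h2 ha0)
  obtain ⟨z, hz, -⟩ := hensels_lemma (p := l) (R := ℤ_[l])
    (F := (Polynomial.X ^ 2 - Polynomial.C w)) (a := a) (by
      have hF : ‖a ^ 2 - w‖ < 1 := (hker _).mpr (by simp [hr, pow_two])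
      have hd : ((Polynomial.X ^ 2 - Polynomial.C w).derivative).aeval a = 2 * a := by
        simp [one_add_one_eq_two]
      rw [hd, hder]
      simpa using hF)
  exact ⟨z, by simpa [sub_eq_zero] using hz⟩

/-! ### Norm values over `ℚ_l` when `d = l u` with `l ∤ u`. -/

section OddPrime

variable {l : ℕ} [Fact l.Prime] {u : ℤ}

theorem padic_norm_intCast_eq_one {v : ℤ} (hv : ¬ (l : ℤ) ∣ v) : ‖(v : ℚ_[l])‖ = 1 :=
  le_antisymm (Padic.norm_int_le_one v)
    (not_lt.mp fun h => hv (Padic.norm_intCast_lt_one_iff.mp h))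

theorem padic_norm_prime_mul (hu : ¬ (l : ℤ) ∣ u) :
    ‖(((l : ℤ) * u : ℤ) : ℚ_[l])‖ = (l : ℝ)⁻¹ := by
  push_cast
  rw [norm_mul, padic_norm_intCast_eq_one hu, Padic.norm_p, mul_one]

/-- The element `-d` is a norm value of valuation one, so dividing `a` by a power of it leaves a
unit. -/
theorem exists_unit_mul_normValue (hu : ¬ (l : ℤ) ∣ u) {a : ℚ_[l]} (ha : a ≠ 0) :
    ∃ (w : ℤ_[l]) (h : ℚ_[l]), ‖w‖ = 1 ∧ h ≠ 0 ∧
      IsNormValue (((l : ℤ) * u : ℤ) : ℚ_[l]) h ∧ a = w * h := by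
  set d : ℚ_[l] := (((l : ℤ) * u : ℤ) : ℚ_[l]) with hd
  have hnd : ‖d‖ = (l : ℝ)⁻¹ := padic_norm_prime_mul hu
  have hl0 : (l : ℝ) ≠ 0 := by exact_mod_cast (Fact.out : l.Prime).ne_zero
  have hd0 : d ≠ 0 := by
    rw [← norm_ne_zero_iff, hnd]
    exact inv_ne_zero hl0
  set h := (-d) ^ a.valuation with hh
  have h0 : h ≠ 0 := zpow_ne_zero _ (neg_ne_zero.mpr hd0)
  have hn : ‖a / h‖ = 1 := by
    rw [norm_div, hh, norm_zpow, norm_neg, hnd, Padic.norm_eq_zpow_neg_valuation ha, inv_zpow,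
      zpow_neg, div_self]
    exact inv_ne_zero (zpow_ne_zero _ hl0)
  refine ⟨⟨a / h, hn.le⟩, h, hn, h0, (IsNormValue.neg_self d).zpow _, ?_⟩
  change a = a / h * h
  rw [div_mul_cancel₀ _ h0]

theorem isNormValue_of_isSquare_toZMod (hl : l ≠ 2) (d : ℚ_[l]) {w : ℤ_[l]} (hw : ‖w‖ = 1)
    (h : IsSquare (PadicInt.toZMod w)) : IsNormValue d w := by
  obtain ⟨z, rfl⟩ := isSquare_of_isSquare_toZMod hl hw h
  simpa using IsNormValue.sq d (z : ℚ_[l])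

theorem isSquare_mul_of_not_isSquare (hl : l ≠ 2) {a b : ZMod l} (ha : ¬ IsSquare a)
    (hb : ¬ IsSquare b) : IsSquare (a * b) := by
  have hc : ringChar (ZMod l) ≠ 2 := by rwa [ZMod.ringChar_zmod_n]
  have ha0 : a ≠ 0 := by rintro rfl; exact ha (IsSquare.zero)
  have hb0 : b ≠ 0 := by rintro rfl; exact hb (IsSquare.zero)
  rw [← quadraticChar_one_iff_isSquare (mul_ne_zero ha0 hb0), map_mul,
    quadraticChar_neg_one_iff_not_isSquare.mpr ha, quadraticChar_neg_one_iff_not_isSquare.mpr hb]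
  norm_num

/-- Modulo norm values only units matter, and square units are norm values. Two nonsquare residues
multiply to a square, so the norm values have index at most two; this makes the symbol
multiplicative. -/
theorem isNormValue_mul_of_not (hl : l ≠ 2) (hu : ¬ (l : ℤ) ∣ u) {a b : ℚ_[l]} (ha0 : a ≠ 0)
    (hb0 : b ≠ 0) (ha : ¬ IsNormValue (((l : ℤ) * u : ℤ) : ℚ_[l]) a)
    (hb : ¬ IsNormValue (((l : ℤ) * u : ℤ) : ℚ_[l]) b) :
    IsNormValue (((l : ℤ) * u : ℤ) : ℚ_[l]) (a * b) := by
  obtain ⟨w, h, hw, h0, hn, rfl⟩ := exists_unit_mul_normValue hu ha0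
  obtain ⟨w', h', hw', h0', hn', rfl⟩ := exists_unit_mul_normValue hu hb0
  have hsq : ¬ IsSquare (PadicInt.toZMod w) := fun hs =>
    ha ((isNormValue_of_isSquare_toZMod hl _ hw hs).mul hn)
  have hsq' : ¬ IsSquare (PadicInt.toZMod w') := fun hs =>
    hb ((isNormValue_of_isSquare_toZMod hl _ hw' hs).mul hn')
  have hww := isNormValue_of_isSquare_toZMod hl (((l : ℤ) * u : ℤ) : ℚ_[l]) (w := w * w')
    (by rw [norm_mul, hw, hw', mul_one])
    (by rw [map_mul]; exact isSquare_mul_of_not_isSquare hl hsq hsq')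
  have := hww.mul (hn.mul hn')
  convert this using 1
  push_cast
  ring

theorem hilbertSym_mul (hl : l ≠ 2) (hu : ¬ (l : ℤ) ∣ u) {a b : ℚ_[l]} (ha0 : a ≠ 0)
    (hb0 : b ≠ 0) : hilbertSym l (a * b) (((l : ℤ) * u : ℤ) : ℚ_[l]) =
      hilbertSym l a (((l : ℤ) * u : ℤ) : ℚ_[l]) * hilbertSym l b (((l : ℤ) * u : ℤ) : ℚ_[l]) := by
  have hd0 : (((l : ℤ) * u : ℤ) : ℚ_[l]) ≠ 0 := by
    rw [← norm_ne_zero_iff, padic_norm_prime_mul hu]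
    exact inv_ne_zero (by exact_mod_cast (Fact.out : l.Prime).ne_zero)
  have ha := hilbertSym_eq_one_iff ha0 hd0
  have hb := hilbertSym_eq_one_iff hb0 hd0
  have hab := hilbertSym_eq_one_iff (mul_ne_zero ha0 hb0) hd0
  by_cases h1 : IsNormValue (((l : ℤ) * u : ℤ) : ℚ_[l]) a
  · by_cases h2 : IsNormValue (((l : ℤ) * u : ℤ) : ℚ_[l]) b
    · rw [ha.mpr h1, hb.mpr h2, hab.mpr (h1.mul h2), mul_one]
    · rw [ha.mpr h1, Int.units_ne_iff_eq_neg.mp (mt hb.mp h2),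
        Int.units_ne_iff_eq_neg.mp (mt hab.mp fun h => h2 (h.of_mul_left h1 ha0)), one_mul]
  · by_cases h2 : IsNormValue (((l : ℤ) * u : ℤ) : ℚ_[l]) b
    · rw [hb.mpr h2, Int.units_ne_iff_eq_neg.mp (mt ha.mp h1),
        Int.units_ne_iff_eq_neg.mp (mt hab.mp fun h =>
          h1 (IsNormValue.of_mul_left (by rwa [mul_comm b a]) h2 hb0)), mul_one]
    · rw [Int.units_ne_iff_eq_neg.mp (mt ha.mp h1), Int.units_ne_iff_eq_neg.mp (mt hb.mp h2),
        hab.mpr (isNormValue_mul_of_not hl hu ha0 hb0 h1 h2)]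
      rfl

/-- The valuations of `x²` and `d y²` have different parity, so no cancellation occurs in `v = x² -
d y²`. Hence `x` and `y` are integral, and reduction modulo `l` leaves `v = x²`. -/
theorem isSquare_of_isNormValue (hu : ¬ (l : ℤ) ∣ u) {v : ℤ} (hv : ¬ (l : ℤ) ∣ v)
    (h : IsNormValue (((l : ℤ) * u : ℤ) : ℚ_[l]) (v : ℚ_[l])) : IsSquare (v : ZMod l) := by
  obtain ⟨x, y, hxy⟩ := h
  set d : ℚ_[l] := (((l : ℤ) * u : ℤ) : ℚ_[l]) with hd
  have hnd : ‖d‖ = (l : ℝ) ^ (-1 : ℤ) := by rw [padic_norm_prime_mul hu, zpow_neg_one]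
  have hl1 : (1 : ℝ) < l := by exact_mod_cast (Fact.out : l.Prime).one_lt
  have hl0 : (l : ℝ) ≠ 0 := by positivity
  have hnv := padic_norm_intCast_eq_one hv
  have hdy : y ≠ 0 → ‖-(d * y ^ 2)‖ = (l : ℝ) ^ (-1 - 2 * y.valuation) := fun hy => by
    rw [norm_neg, norm_mul, norm_pow, hnd, Padic.norm_eq_zpow_neg_valuation hy, ← zpow_natCast,
      ← zpow_mul, ← zpow_add₀ hl0]
    congr 1
    push_cast
    ring
  have hne : y ≠ 0 → ‖x ^ 2‖ ≠ ‖-(d * y ^ 2)‖ := fun hy h => by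
    have hx : x ≠ 0 := by
      rintro rfl
      rw [hdy hy] at h
      simp only [ne_eq, OfNat.ofNat_ne_zero, not_false_eq_true, zero_pow, norm_zero] at h
      exact zpow_ne_zero _ hl0 h.symm
    rw [hdy hy, norm_pow, Padic.norm_eq_zpow_neg_valuation hx, ← zpow_natCast, ← zpow_mul] at h
    have := zpow_right_injective₀ (by positivity) hl1.ne' h
    push_cast at this
    omega
  have hmax : max ‖x ^ 2‖ ‖-(d * y ^ 2)‖ = 1 := by
    by_cases hy : y = 0
    · subst hy
      have : ‖x ^ 2‖ = 1 := by rw [← hnv, hxy]; simp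
      simp only [ne_eq, OfNat.ofNat_ne_zero, not_false_eq_true, zero_pow, mul_zero, neg_zero,
        norm_zero, this]
      norm_num
    · rw [← Padic.add_eq_max_of_ne (hne hy), ← sub_eq_add_neg, ← hxy, hnv]
  have hx1 : ‖x‖ ≤ 1 := by
    have h1 : ‖x‖ ^ 2 ≤ 1 := by rw [← norm_pow, ← hmax]; exact le_max_left _ _
    exact (pow_le_one_iff_of_nonneg (norm_nonneg _) two_ne_zero).mp h1
  have hy1 : ‖y‖ ≤ 1 := by
    by_cases hy : y = 0
    · simp [hy]
    have h1 : (l : ℝ) ^ (-1 - 2 * y.valuation) ≤ (l : ℝ) ^ (0 : ℤ) := by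
      rw [← hdy hy, zpow_zero, ← hmax]; exact le_max_right _ _
    rw [zpow_le_zpow_iff_right₀ hl1] at h1
    rw [Padic.norm_eq_zpow_neg_valuation hy, ← zpow_zero (l : ℝ), zpow_le_zpow_iff_right₀ hl1]
    omega
  obtain ⟨x, rfl⟩ : ∃ x' : ℤ_[l], (x' : ℚ_[l]) = x := ⟨⟨x, hx1⟩, rfl⟩
  obtain ⟨y, rfl⟩ : ∃ y' : ℤ_[l], (y' : ℚ_[l]) = y := ⟨⟨y, hy1⟩, rfl⟩
  have hZ : (v : ℤ_[l]) = x ^ 2 - (((l : ℤ) * u : ℤ) : ℤ_[l]) * y ^ 2 := by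
    apply Subtype.ext
    push_cast
    rw [hxy, hd]
    push_cast
    rfl
  have := congrArg PadicInt.toZMod hZ
  simp only [map_sub, map_pow, map_mul, map_intCast] at this
  push_cast at this
  rw [CharP.cast_eq_zero] at this
  exact ⟨_, by rw [this]; ring⟩

theorem hilbertSym_eq_legendreSym (hl : l ≠ 2) (hu : ¬ (l : ℤ) ∣ u) {v : ℤ}
    (hv : ¬ (l : ℤ) ∣ v) :
    ((hilbertSym l (v : ℚ_[l]) (((l : ℤ) * u : ℤ) : ℚ_[l]) : ℤˣ) : ℤ) = legendreSym l v := by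
  have hd0 : (((l : ℤ) * u : ℤ) : ℚ_[l]) ≠ 0 := by
    rw [← norm_ne_zero_iff, padic_norm_prime_mul hu]
    exact inv_ne_zero (by exact_mod_cast (Fact.out : l.Prime).ne_zero)
  have hnv := padic_norm_intCast_eq_one hv
  have hv0 : (v : ℚ_[l]) ≠ 0 := by
    rw [← norm_ne_zero_iff, hnv]
    exact one_ne_zero
  have hvZ : (v : ZMod l) ≠ 0 := by rwa [Ne, ZMod.intCast_zmod_eq_zero_iff_dvd]
  have h1 := hilbertSym_eq_one_iff hv0 hd0
  by_cases hs : IsSquare (v : ZMod l)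
  · rw [(legendreSym.eq_one_iff l hvZ).mpr hs, h1.mpr]
    · rfl
    · have := isNormValue_of_isSquare_toZMod hl (((l : ℤ) * u : ℤ) : ℚ_[l])
        (w := (v : ℤ_[l])) (by simpa using hnv) (by simpa using hs)
      simpa using this
  · rw [(legendreSym.eq_neg_one_iff l).mpr hs,
      Int.units_ne_iff_eq_neg.mp (mt h1.mp fun h => hs (isSquare_of_isNormValue hu hv h))]
    rfl

end OddPrime

/-! ### Imaginary quadratic fields of odd discriminant -/

section Coordinates

variable {F : Type*} [Field F] [NumberField F]

/-- A negative rational has no rational square root, so the quadratic algebra is a field and the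
evaluation at `α` is injective. -/
theorem exists_algEquiv_quadraticAlgebra {d : ℚ} (hd : d < 0) {α : F}
    (hα : α ^ 2 = algebraMap ℚ F d) (hgen : IntermediateField.adjoin ℚ {α} = ⊤) :
    ∃ e : QuadraticAlgebra ℚ d 0 ≃ₐ[ℚ] F,
      ∀ x y : ℚ, e ⟨x, y⟩ = algebraMap ℚ F x + algebraMap ℚ F y * α := by
  have : Fact (∀ r : ℚ, r ^ 2 ≠ d + 0 * r) := ⟨fun r h => by nlinarith [sq_nonneg r]⟩
  let φ : QuadraticAlgebra ℚ d 0 →ₐ[ℚ] F := QuadraticAlgebra.lift ⟨α, by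
    rw [← pow_two, hα, Algebra.smul_def, zero_smul, mul_one, add_zero]⟩
  have hφ : ∀ x y : ℚ, φ ⟨x, y⟩ = algebraMap ℚ F x + algebraMap ℚ F y * α := fun x y => by
    simp [φ, QuadraticAlgebra.lift, Algebra.smul_def]
    rfl
  have hsurj : Function.Surjective φ := by
    rw [← AlgHom.range_eq_top, ← top_le_iff, ← IntermediateField.top_toSubalgebra, ← hgen,
      IntermediateField.adjoin_simple_toSubalgebra_of_isAlgebraic
        (Algebra.IsAlgebraic.isAlgebraic α)]
    refine Algebra.adjoin_le ?_
    rintro _ rfl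
    exact ⟨⟨0, 1⟩, by simp [hφ]⟩
  exact ⟨AlgEquiv.ofBijective φ ⟨φ.injective, hsurj⟩, hφ⟩

theorem norm_quadraticAlgebra {d : ℚ} (x y : ℚ) :
    Algebra.norm ℚ (⟨x, y⟩ : QuadraticAlgebra ℚ d 0) = x ^ 2 - d * y ^ 2 := by
  rw [Algebra.norm_apply]
  have h := QuadraticAlgebra.det_toLinearMap_eq_norm (⟨x, y⟩ : QuadraticAlgebra ℚ d 0)
  rw [QuadraticAlgebra.norm_def] at h
  refine Eq.trans h ?_
  ring

theorem exists_int_of_sq_mul_squarefree {Δ M : ℤ} (hΔ : Squarefree Δ) {w : ℚ}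
    (h : w ^ 2 * Δ = M) : ∃ k : ℤ, (k : ℚ) = w := by
  have hden : (w.den : ℚ) ≠ 0 := by exact_mod_cast w.den_nz
  have h1 : (w.num : ℚ) ^ 2 * Δ = M * (w.den : ℚ) ^ 2 := by
    rw [← h]
    nth_rewrite 2 [← Rat.num_div_den w]
    field_simp
  have h2 : w.num ^ 2 * Δ = M * (w.den : ℤ) ^ 2 := by exact_mod_cast h1
  have hco : IsCoprime ((w.den : ℤ) ^ 2) (w.num ^ 2) := by
    refine IsCoprime.pow ?_
    rw [isCoprime_comm, Int.isCoprime_iff_nat_coprime]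
    simpa using w.reduced
  have h3 : (w.den : ℤ) ^ 2 ∣ Δ := hco.dvd_of_dvd_mul_left ⟨M, by rw [h2]; ring⟩
  have h4 : IsUnit (w.den : ℤ) := hΔ _ (by rwa [← pow_two])
  have h5 : w.den = 1 := by simpa using Int.isUnit_iff_natAbs_eq.mp h4
  exact ⟨w.num, Rat.coe_int_num_of_den_eq_one h5⟩

/-- `s` is a square root of the squarefree integer `Δ < 0`, `Δ ≡ 1 (mod 4)`, and every integer
of `F` is of the form `(x + y s) / 2`. -/
structure IsQuadGen (Δ : ℤ) (s : 𝓞 F) : Prop where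
  sq : s ^ 2 = (Δ : 𝓞 F)
  coords : ∀ β : 𝓞 F, ∃ x y : ℤ, 2 * β = x + y * s ∧ 4 * Algebra.norm ℤ β = x ^ 2 - Δ * y ^ 2
  half : ∃ w : 𝓞 F, 2 * w = 1 + s
  neg : Δ < 0
  sqfree : Squarefree Δ
  mod_four : Δ % 4 = 1

theorem exists_isQuadGen {Δ : ℤ} (hneg : Δ < 0) (hsq : Squarefree Δ) (hmod : Δ % 4 = 1) {α : F}
    (hα : α ^ 2 = (Δ : F)) (hgen : IntermediateField.adjoin ℚ {α} = ⊤) :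
    ∃ s : 𝓞 F, IsQuadGen Δ s := by
  have hint : IsIntegral ℤ α := by
    refine IsIntegral.of_pow (n := 2) two_pos ?_
    rw [hα]
    exact isIntegral_algebraMap (R := ℤ) (x := Δ)
  obtain ⟨e, he⟩ := exists_algEquiv_quadraticAlgebra (F := F) (d := Δ) (by exact_mod_cast hneg)
    (by simpa using hα) hgen
  have hnorm : ∀ x y : ℚ, Algebra.norm ℚ (algebraMap ℚ F x + algebraMap ℚ F y * α) =
      x ^ 2 - Δ * y ^ 2 := fun x y => by
    rw [← he, ← norm_quadraticAlgebra]
    exact Algebra.norm_eq_of_algEquiv e _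
  obtain ⟨s, hs⟩ : ∃ s : 𝓞 F, algebraMap (𝓞 F) F s = α := ⟨⟨α, hint⟩, rfl⟩
  refine ⟨s, ?_, fun β => ?_, ?_, hneg, hsq, hmod⟩
  · apply NumberField.RingOfIntegers.coe_injective
    rw [map_pow, hs, hα, map_intCast]
  · obtain ⟨⟨x, y⟩, hz⟩ := e.surjective (algebraMap (𝓞 F) F β)
    rw [he] at hz
    have h0 : ((Algebra.norm ℤ β : ℤ) : ℚ) = x ^ 2 - Δ * y ^ 2 := by
      rw [Algebra.coe_norm_int, ← hnorm, hz]
    have h1 : ((Algebra.norm ℤ (β + 1) : ℤ) : ℚ) = (x + 1) ^ 2 - Δ * y ^ 2 := by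
      rw [Algebra.coe_norm_int, ← hnorm]
      congr 1
      change algebraMap (𝓞 F) F (β + 1) = _
      simp only [map_add, map_one, ← hz]
      ring
    -- This is the trace `2x`, obtained from norms. Then `(2y)² Δ = X² - 4 N(β)` is an integer, and
    -- `2y` is integral because `Δ` is squarefree.
    set X : ℤ := Algebra.norm ℤ (β + 1) - Algebra.norm ℤ β - 1 with hX
    have hXx : (X : ℚ) = 2 * x := by
      rw [hX]
      push_cast
      rw [h0, h1]
      ring
    obtain ⟨Y, hY⟩ := exists_int_of_sq_mul_squarefree hsq
      (w := 2 * y) (M := X ^ 2 - 4 * Algebra.norm ℤ β) (by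
        push_cast
        rw [hXx, h0]
        ring)
    refine ⟨X, Y, ?_, ?_⟩
    · apply NumberField.RingOfIntegers.coe_injective
      have e1 : (X : F) = 2 * algebraMap ℚ F x := by
        rw [← map_intCast (algebraMap ℚ F) X, hXx, map_mul, map_ofNat]
      have e2 : (Y : F) = 2 * algebraMap ℚ F y := by
        rw [← map_intCast (algebraMap ℚ F) Y, hY, map_mul, map_ofNat]
      simp only [map_add, map_mul, map_intCast, map_ofNat]
      rw [← hz, e1, e2, hs]
      ring
    · have : ((4 * Algebra.norm ℤ β : ℤ) : ℚ) = ((X ^ 2 - Δ * Y ^ 2 : ℤ) : ℚ) := by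
        push_cast
        rw [hXx, hY, h0]
        ring
      exact_mod_cast this
  · have hw : IsIntegral ℤ ((1 + α) / 2) := by
      refine ⟨Polynomial.X ^ 2 - Polynomial.X + Polynomial.C ((1 - Δ) / 4), ?_, ?_⟩
      · monicity!
      · obtain ⟨k, hk⟩ : ∃ k, Δ = 4 * k + 1 := ⟨Δ / 4, by omega⟩
        have hk' : (1 - Δ) / 4 = -k := by omega
        rw [hk']
        have hα' : α ^ 2 = 4 * k + 1 := by rw [hα, hk]; push_cast; ring
        simp only [Polynomial.eval₂_add, Polynomial.eval₂_sub, Polynomial.eval₂_pow,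
          Polynomial.eval₂_X, Polynomial.eval₂_C]
        simp only [algebraMap_int_eq, eq_intCast, Int.cast_neg]
        linear_combination hα' / 4
    obtain ⟨w, hw'⟩ : ∃ w : 𝓞 F, algebraMap (𝓞 F) F w = (1 + α) / 2 := ⟨⟨_, hw⟩, rfl⟩
    refine ⟨w, ?_⟩
    apply NumberField.RingOfIntegers.coe_injective
    simp only [map_add, map_mul, map_one, map_ofNat]
    rw [hw', hs]
    ring

end Coordinates

/-! ### Norms and divisibility in coordinates. -/

namespace IsQuadGen

variable {F : Type*} [Field F] [NumberField F] {Δ : ℤ} {s : 𝓞 F}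

theorem dvd_of_coords_dvd {q : ℕ} (hq : q.Prime) {β : 𝓞 F} {x y : ℤ} (hβ : 2 * β = x + y * s)
    (hx : (q : ℤ) ∣ x) (hy : (q : ℤ) ∣ y) (h2 : q ≠ 2) : (q : 𝓞 F) ∣ β := by
  obtain ⟨x, rfl⟩ := hx
  obtain ⟨y, rfl⟩ := hy
  obtain ⟨k, hk⟩ : ∃ k, q = 2 * k + 1 := (hq.eq_two_or_odd'.resolve_left h2)
  refine ⟨β - k * (x + y * s), ?_⟩
  have hk' : (q : 𝓞 F) = 2 * k + 1 := by exact_mod_cast hk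
  push_cast at hβ
  linear_combination -k * hβ - β * hk'

variable (h : IsQuadGen Δ s)
include h

theorem eq_zero_of_add_mul_eq_zero {x y : ℤ} (hxy : (x : 𝓞 F) + y * s = 0) : x = 0 ∧ y = 0 := by
  have h1 : ((x ^ 2 : ℤ) : 𝓞 F) = ((y ^ 2 * Δ : ℤ) : 𝓞 F) := by
    push_cast
    rw [← h.sq]
    linear_combination (x - y * s) * hxy
  have h2 : x ^ 2 = y ^ 2 * Δ := by exact_mod_cast h1
  have hy : y = 0 := by
    by_contra hy
    have : 0 < y ^ 2 := by positivity
    nlinarith [h.neg, sq_nonneg x]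
  subst hy
  simpa using h2

theorem coords_unique {x y x' y' : ℤ} (hxy : (x : 𝓞 F) + y * s = x' + y' * s) :
    x = x' ∧ y = y' := by
  have := h.eq_zero_of_add_mul_eq_zero (x := x - x') (y := y - y') (by
    push_cast
    linear_combination hxy)
  omega

theorem norm_of_coords {β : 𝓞 F} {x y : ℤ} (hβ : 2 * β = x + y * s) :
    4 * Algebra.norm ℤ β = x ^ 2 - Δ * y ^ 2 := by
  obtain ⟨x', y', h1, h2⟩ := h.coords β
  obtain ⟨rfl, rfl⟩ := h.coords_unique (hβ.symm.trans h1)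
  exact h2

theorem norm_intCast (m : ℤ) : Algebra.norm ℤ (m : 𝓞 F) = m ^ 2 := by
  have := h.norm_of_coords (β := (m : 𝓞 F)) (x := 2 * m) (y := 0) (by push_cast; ring)
  linarith

theorem norm_natCast (m : ℕ) : Algebra.norm ℤ (m : 𝓞 F) = (m : ℤ) ^ 2 := by
  rw [← h.norm_intCast, Int.cast_natCast]

theorem norm_nonneg (β : 𝓞 F) : 0 ≤ Algebra.norm ℤ β := by
  obtain ⟨x, y, -, h2⟩ := h.coords β
  nlinarith [h.neg, sq_nonneg x, sq_nonneg y]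

theorem absNorm_span (β : 𝓞 F) : (Ideal.absNorm (Ideal.span {β}) : ℤ) = Algebra.norm ℤ β := by
  rw [Ideal.absNorm_span_singleton, Int.natAbs_of_nonneg (h.norm_nonneg β)]

theorem absNorm_span_natCast (m : ℕ) : Ideal.absNorm (Ideal.span {(m : 𝓞 F)}) = m ^ 2 := by
  have := h.absNorm_span (m : 𝓞 F)
  rw [h.norm_natCast] at this
  exact_mod_cast this

theorem natCast_dvd_natCast {a b : ℕ} (hab : (a : 𝓞 F) ∣ (b : 𝓞 F)) : a ∣ b := by
  have := map_dvd (Algebra.norm ℤ) hab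
  rw [h.norm_natCast, h.norm_natCast, Int.pow_dvd_pow_iff two_ne_zero] at this
  exact_mod_cast this

/-- `2β = x + y s` has `x` and `y` of the same parity. -/
theorem parity {β : 𝓞 F} {x y : ℤ} (hβ : 2 * β = x + y * s) : x % 2 = y % 2 := by
  have h1 := h.norm_of_coords hβ
  obtain ⟨k, hk⟩ : ∃ k, Δ = 4 * k + 1 := ⟨Δ / 4, by have := h.mod_four; omega⟩
  rw [hk] at h1
  have h2 : 2 ∣ (x - y) * (x + y) :=
    ⟨2 * Algebra.norm ℤ β + 2 * k * y ^ 2, by linear_combination -h1⟩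
  rcases Int.prime_two.dvd_or_dvd h2 with h3 | h3 <;> omega

/-- An unramified prime is radical. -/
theorem dvd_of_dvd_sq {q : ℕ} (hq : q.Prime) (hqΔ : ¬ (q : ℤ) ∣ Δ) {β : 𝓞 F}
    (hβ : (q : 𝓞 F) ∣ β ^ 2) : (q : 𝓞 F) ∣ β := by
  have hq' : Prime (q : ℤ) := Nat.prime_iff_prime_int.mp hq
  obtain ⟨γ, hγ⟩ := hβ
  obtain ⟨x, y, h1, h2⟩ := h.coords β
  obtain ⟨x', y', h1', -⟩ := h.coords γ
  have hN : (q : ℤ) ∣ Algebra.norm ℤ β := by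
    have := congrArg (Algebra.norm ℤ) hγ
    rw [map_pow, map_mul, h.norm_natCast] at this
    exact hq'.dvd_of_dvd_pow (n := 2) ⟨q * Algebra.norm ℤ γ, by rw [this]; ring⟩
  -- Comparing rational parts in `β² = qγ`. Together with the norm equation this gives `x² = q x' +
  -- 2 N(β)`, hence `q ∣ x`.
  have h3 : x ^ 2 + Δ * y ^ 2 = 2 * q * x' := by
    refine (h.coords_unique (x := x ^ 2 + Δ * y ^ 2) (y := 2 * x * y) (x' := 2 * q * x')
      (y' := 2 * q * y') ?_).1
    push_cast
    rw [← h.sq]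
    linear_combination (-(x + y * s) - 2 * β) * h1 + 4 * hγ + 2 * q * h1'
  have h4 : x ^ 2 = q * x' + 2 * Algebra.norm ℤ β := by linarith
  have hx : (q : ℤ) ∣ x := by
    refine hq'.dvd_of_dvd_pow (n := 2) ?_
    rw [h4]
    exact dvd_add (dvd_mul_right _ _) (dvd_mul_of_dvd_right hN _)
  have hy : (q : ℤ) ∣ y := by
    have : (q : ℤ) ∣ Δ * y ^ 2 := by
      rw [show Δ * y ^ 2 = x ^ 2 - 4 * Algebra.norm ℤ β by rw [h2]; ring]
      exact dvd_sub (dvd_pow hx two_ne_zero) (dvd_mul_of_dvd_right hN _)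
    exact hq'.dvd_of_dvd_pow ((hq'.dvd_or_dvd this).resolve_left hqΔ)
  -- At `q = 2`, even coordinates only give `β = x + y s`. The even norm forces `x ≡ y (mod 2)`, and
  -- then `β = (x - y) + y (1 + s)` is divisible by `2`.
  by_cases hq2 : q = 2
  · subst hq2
    obtain ⟨x, rfl⟩ := hx
    obtain ⟨y, rfl⟩ := hy
    obtain ⟨w, hw⟩ := h.half
    obtain ⟨k, hk⟩ : ∃ k, Δ = 4 * k + 1 := ⟨Δ / 4, by have := h.mod_four; omega⟩
    have h5 : (2 : ℤ) ∣ (x - y) * (x + y) := by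
      obtain ⟨m, hm⟩ := hN
      refine ⟨m + 2 * k * y ^ 2, ?_⟩
      rw [hm, hk] at h2
      push_cast at h2
      linarith
    obtain ⟨j, hj⟩ : (2 : ℤ) ∣ x - y := by
      rcases Int.prime_two.dvd_or_dvd h5 with h6 | h6 <;> omega
    refine ⟨j + y * w, ?_⟩
    have hx : (x : 𝓞 F) = y + 2 * j := by
      have : x = y + 2 * j := by omega
      exact_mod_cast this
    refine mul_left_cancel₀ (two_ne_zero : (2 : 𝓞 F) ≠ 0) ?_
    push_cast at h1 ⊢
    rw [h1, hx]
    linear_combination -2 * y * hw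
  · exact dvd_of_coords_dvd hq h1 hx hy hq2

end IsQuadGen

/-! ### Ideals, their classes and the 2-torsion of the class group. -/

section Ideals

variable {F : Type*} [Field F] [NumberField F]

theorem ideal_eq_of_sq_eq {I J : Ideal (𝓞 F)} (h : I ^ 2 = J ^ 2) : I = J :=
  dvd_antisymm ((UniqueFactorizationMonoid.pow_dvd_pow_iff_dvd two_ne_zero).mp h.dvd)
    ((UniqueFactorizationMonoid.pow_dvd_pow_iff_dvd two_ne_zero).mp h.symm.dvd)

theorem mk0_eq_of_span_mul_eq {x y : 𝓞 F} (hx : x ≠ 0) (hy : y ≠ 0) {I J : (Ideal (𝓞 F))⁰}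
    (h : Ideal.span {x} * (I : Ideal (𝓞 F)) = Ideal.span {y} * (J : Ideal (𝓞 F))) :
    ClassGroup.mk0 I = ClassGroup.mk0 J :=
  ClassGroup.mk0_eq_mk0_iff.mpr ⟨x, y, hx, hy, h⟩

theorem mem_nonZeroDivisors_of_span_mul {x : 𝓞 F} {I : (Ideal (𝓞 F))⁰} {J : Ideal (𝓞 F)}
    (h : (I : Ideal (𝓞 F)) = Ideal.span {x} * J) : J ∈ (Ideal (𝓞 F))⁰ := by
  refine mem_nonZeroDivisors_of_ne_zero ?_
  rintro rfl
  rw [mul_zero] at h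
  exact nonZeroDivisors.coe_ne_zero I h

/-- An ideal contained in `(q)` can be divided by `q` without changing its class. -/
theorem exists_of_le_span_natCast {q : ℕ} (hq : q ≠ 0) (I : (Ideal (𝓞 F))⁰)
    (hI : (I : Ideal (𝓞 F)) ≤ Ideal.span {(q : 𝓞 F)}) :
    ∃ J : (Ideal (𝓞 F))⁰, (I : Ideal (𝓞 F)) = Ideal.span {(q : 𝓞 F)} * J ∧
      ClassGroup.mk0 J = ClassGroup.mk0 I := by
  obtain ⟨J, hJ⟩ := Ideal.dvd_iff_le.mpr hI
  refine ⟨⟨J, mem_nonZeroDivisors_of_span_mul hJ⟩, hJ, ?_⟩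
  refine mk0_eq_of_span_mul_eq (x := (q : 𝓞 F)) (y := 1) (by exact_mod_cast hq) one_ne_zero ?_
  rw [← hJ, Ideal.span_singleton_one, Ideal.top_mul]

end Ideals

namespace IsQuadGen

variable {F : Type*} [Field F] [NumberField F] {Δ : ℤ} {s : 𝓞 F} (h : IsQuadGen Δ s)
include h

theorem delta_ne_zero : Δ ≠ 0 := h.neg.ne

/-- The ideal `(D, √Δ)`, for a divisor `D` of `Δ`, has square `(D)`. -/
theorem span_pair_sq {D : ℕ} (hD : (D : ℤ) ∣ Δ) :
    (Ideal.span {(D : 𝓞 F), s}) ^ 2 = Ideal.span {(D : 𝓞 F)} := by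
  obtain ⟨E, hE⟩ := hD
  have hs : s * s = (D : 𝓞 F) * E := by
    rw [← pow_two, h.sq, hE]
    push_cast
    rfl
  have hco : IsCoprime (D : ℤ) E := by
    have := h.sqfree
    rw [hE] at this
    exact (squarefree_mul_iff.mp this).1.isCoprime
  obtain ⟨u, v, huv⟩ := hco
  have huv' : (u : 𝓞 F) * D + v * E = 1 := by exact_mod_cast congrArg (Int.cast : ℤ → 𝓞 F) huv
  rw [pow_two, Ideal.span_pair_mul_span_pair]
  apply le_antisymm
  · rw [Ideal.span_le]
    rintro z hz
    simp only [Set.mem_insert_iff, Set.mem_singleton_iff] at hz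
    rw [SetLike.mem_coe, Ideal.mem_span_singleton]
    rcases hz with rfl | rfl | rfl | rfl
    · exact dvd_mul_right _ _
    · exact dvd_mul_right _ _
    · exact dvd_mul_left _ _
    · exact ⟨E, hs⟩
  · rw [Ideal.span_singleton_le_iff_mem]
    have : (D : 𝓞 F) = u * (D * D) + v * (s * s) := by
      rw [hs]
      linear_combination -(D : 𝓞 F) * huv'
    have hmem := Ideal.add_mem (Ideal.span {(D : 𝓞 F) * D, D * s, s * D, s * s})
      (Ideal.mul_mem_left _ (u : 𝓞 F) (Ideal.subset_span (by simp : (D : 𝓞 F) * D ∈ _)))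
      (Ideal.mul_mem_left _ (v : 𝓞 F) (Ideal.subset_span (by simp : s * s ∈ _)))
    rwa [← this] at hmem

theorem exists_isRootIdeal {D : ℕ} (hD : (D : ℤ) ∣ Δ) :
    ∃ 𝔞 : (Ideal (𝓞 F))⁰, IsRootIdeal F D 𝔞 := by
  refine ⟨⟨Ideal.span {(D : 𝓞 F), s}, mem_nonZeroDivisors_of_ne_zero fun h0 => ?_⟩,
    h.span_pair_sq hD⟩
  have h1 := h.span_pair_sq hD
  rw [h0] at h1
  have h2 : (D : 𝓞 F) = 0 := by
    rw [← Ideal.span_singleton_eq_bot, ← h1]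
    simp
  have h3 : D = 0 := by exact_mod_cast h2
  subst h3
  exact h.delta_ne_zero (by simpa using hD)

theorem absNorm_of_isRootIdeal {D : ℕ} {𝔞 : (Ideal (𝓞 F))⁰} (ha : IsRootIdeal F D 𝔞) :
    Ideal.absNorm (𝔞 : Ideal (𝓞 F)) = D := by
  have h1 := congrArg Ideal.absNorm ha
  rw [map_pow, h.absNorm_span_natCast] at h1
  exact (Nat.pow_left_injective (n := 2) two_ne_zero) h1

/-- A class of order at most two contains an ideal whose square is generated by a positive
rational integer. -/
theorem exists_sq_eq_span_natCast {c : ClassGroup (𝓞 F)} (hc : c ^ 2 = 1) :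
    ∃ r : ℕ, 0 < r ∧ ∃ K : (Ideal (𝓞 F))⁰, ClassGroup.mk0 K = c ∧ IsRootIdeal F r K := by
  obtain ⟨I, rfl⟩ := ClassGroup.mk0_surjective c
  rw [pow_two, ← map_mul, ClassGroup.mk0_eq_one_iff] at hc
  obtain ⟨⟨γ, hγ⟩⟩ := hc
  change (I : Ideal (𝓞 F)) * I = Ideal.span {γ} at hγ
  have hI0 : (I : Ideal (𝓞 F)) ≠ 0 := nonZeroDivisors.coe_ne_zero I
  have hγ0 : γ ≠ 0 := by
    rintro rfl
    rw [Ideal.span_singleton_eq_bot.mpr rfl] at hγ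
    exact mul_ne_zero hI0 hI0 hγ
  set m := Ideal.absNorm (I : Ideal (𝓞 F)) with hm
  have hm0 : 0 < m := Ideal.absNorm_pos_of_nonZeroDivisors I
  have hN : Algebra.norm ℤ γ = (m : ℤ) ^ 2 := by
    rw [← h.absNorm_span, ← hγ, map_mul]
    push_cast
    ring
  -- An explicit Hilbert 90 for `γ/m`, which has norm one. With `δ = γ + m` and `x` the trace of
  -- `γ`, one has `δ² = γ (x + 2m)`, so `K = I δ / γ` has square `(x + 2m)`. When `δ = 0`, the ideal
  -- `I` itself works.
  by_cases hδ : γ + m = 0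
  · refine ⟨m, hm0, I, rfl, ?_⟩
    rw [IsRootIdeal, pow_two, hγ, eq_neg_of_add_eq_zero_left hδ, Ideal.span_singleton_neg]
  · obtain ⟨x, y, h1, h2⟩ := h.coords γ
    have hγ2 : γ ^ 2 = x * γ - (m : 𝓞 F) ^ 2 := by
      rw [hN] at h2
      have h2' : 4 * (m : 𝓞 F) ^ 2 = x ^ 2 - Δ * y ^ 2 := by
        exact_mod_cast congrArg (Int.cast : ℤ → 𝓞 F) h2
      refine mul_left_cancel₀ (by norm_num : (4 : 𝓞 F) ≠ 0) ?_
      rw [← h.sq] at h2'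
      linear_combination (2 * γ + x + y * s - 2 * x) * h1 + h2'
    set r : ℤ := x + 2 * m with hr
    have hδ2 : (γ + m) ^ 2 = γ * (r : 𝓞 F) := by
      rw [hr]
      push_cast
      linear_combination hγ2
    have hr0 : r ≠ 0 := by
      intro h0
      rw [h0, Int.cast_zero, mul_zero] at hδ2
      exact hδ (pow_eq_zero_iff two_ne_zero |>.mp hδ2)
    have hspan : Ideal.span {((r.natAbs : ℕ) : 𝓞 F)} = Ideal.span {(r : 𝓞 F)} := by
      rw [Ideal.span_singleton_eq_span_singleton]
      rcases Int.natAbs_eq r with h3 | h3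
      · conv_rhs => rw [h3]
        simp
      · conv_rhs => rw [h3]
        simp
    have hprod : ((I : Ideal (𝓞 F)) * Ideal.span {γ + m}) ^ 2 =
        (Ideal.span {γ}) ^ 2 * Ideal.span {(r : 𝓞 F)} := by
      rw [mul_pow, pow_two, hγ, Ideal.span_singleton_pow, hδ2, Ideal.span_singleton_pow,
        Ideal.span_singleton_mul_span_singleton, Ideal.span_singleton_mul_span_singleton]
      congr 2
      ring
    obtain ⟨K, hK⟩ : Ideal.span {γ} ∣ (I : Ideal (𝓞 F)) * Ideal.span {γ + m} :=
      (UniqueFactorizationMonoid.pow_dvd_pow_iff_dvd two_ne_zero).mp ⟨_, hprod⟩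
    have hK2 : K ^ 2 = Ideal.span {(r : 𝓞 F)} := by
      rw [hK, mul_pow] at hprod
      refine mul_left_cancel₀ (pow_ne_zero 2 ?_) hprod
      simpa [Ideal.span_singleton_eq_bot] using hγ0
    have hK0 : K ≠ 0 := by
      rintro rfl
      rw [zero_pow two_ne_zero] at hK2
      have h4 : (r : 𝓞 F) = 0 := by
        rw [← Ideal.span_singleton_eq_bot, ← hK2]
        rfl
      exact hr0 (by exact_mod_cast h4)
    refine ⟨r.natAbs, Int.natAbs_pos.mpr hr0, ⟨K, mem_nonZeroDivisors_of_ne_zero hK0⟩, ?_, ?_⟩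
    · refine mk0_eq_of_span_mul_eq hγ0 hδ ?_
      rw [← hK, mul_comm]
    · rw [IsRootIdeal, hspan]
      exact hK2

/-- Every `a ∈ K` satisfies `r ∣ a²`. Then `q ∣ a` because `q` is unramified, or because `q² ∣ a²`
in an integrally closed ring. -/
theorem le_span_of_isRootIdeal {r q : ℕ} (hq : q.Prime) (hqr : q ∣ r) {K : (Ideal (𝓞 F))⁰}
    (hK : IsRootIdeal F r K) (hram : ¬ (q : ℤ) ∣ Δ ∨ q ^ 2 ∣ r) :
    (K : Ideal (𝓞 F)) ≤ Ideal.span {(q : 𝓞 F)} := by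
  intro a ha
  rw [Ideal.mem_span_singleton]
  have h1 : (r : 𝓞 F) ∣ a ^ 2 := by
    rw [← Ideal.mem_span_singleton, ← hK]
    exact Ideal.pow_mem_pow ha 2
  rcases hram with h2 | h2
  · exact h.dvd_of_dvd_sq hq h2 (dvd_trans (by exact_mod_cast Nat.cast_dvd_cast hqr) h1)
  · refine (IsIntegrallyClosed.pow_dvd_pow_iff two_ne_zero).mp (dvd_trans ?_ h1)
    exact_mod_cast Nat.cast_dvd_cast (α := 𝓞 F) h2

/-- Every class of order at most two is the class of an ideal `𝔞` with `𝔞² = (r)`, `r ∣ Δ`. -/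
theorem exists_dvd_isRootIdeal {c : ClassGroup (𝓞 F)} (hc : c ^ 2 = 1) :
    ∃ r : ℕ, (r : ℤ) ∣ Δ ∧ ∃ K : (Ideal (𝓞 F))⁰, ClassGroup.mk0 K = c ∧ IsRootIdeal F r K := by
  classical
  have hex := h.exists_sq_eq_span_natCast hc
  obtain ⟨hr0, K, hKc, hK⟩ := Nat.find_spec hex
  set r := Nat.find hex with hr
  -- Since `r` is the least possible generator, no rational prime can be divided out of `K`. So `r`
  -- has only ramified prime factors, each to the first power.
  have hprim : ∀ q : ℕ, q.Prime → q ∣ r → ¬ (K : Ideal (𝓞 F)) ≤ Ideal.span {(q : 𝓞 F)} := by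
    intro q hq hqr hle
    obtain ⟨J, hJ, hJc⟩ := exists_of_le_span_natCast hq.ne_zero K hle
    have h1 : Ideal.span {((q ^ 2 : ℕ) : 𝓞 F)} * (J : Ideal (𝓞 F)) ^ 2 = Ideal.span {(r : 𝓞 F)} := by
      rw [← hK, hJ, mul_pow, Ideal.span_singleton_pow]
      push_cast
      rfl
    obtain ⟨r', hr'⟩ : q ^ 2 ∣ r := by
      refine h.natCast_dvd_natCast ?_
      rw [← Ideal.span_singleton_le_span_singleton, ← h1]
      exact Ideal.mul_le_left
    have hr'0 : 0 < r' := Nat.pos_of_ne_zero (by rintro rfl; simp at hr'; omega)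
    have h2 : (J : Ideal (𝓞 F)) ^ 2 = Ideal.span {(r' : 𝓞 F)} := by
      rw [hr', Nat.cast_mul, ← Ideal.span_singleton_mul_span_singleton] at h1
      refine mul_left_cancel₀ ?_ h1
      rw [Ne, Ideal.zero_eq_bot, Ideal.span_singleton_eq_bot]
      exact_mod_cast pow_ne_zero 2 hq.ne_zero
    have h3 : r ≤ r' := Nat.find_min' hex ⟨hr'0, J, hJc.trans hKc, h2⟩
    have h4 : 1 < q ^ 2 := Nat.one_lt_pow two_ne_zero hq.one_lt
    nlinarith
  have hram : ∀ q : ℕ, q.Prime → q ∣ r → (q : ℤ) ∣ Δ ∧ ¬ q ^ 2 ∣ r := by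
    intro q hq hqr
    by_contra hcon
    refine hprim q hq hqr (h.le_span_of_isRootIdeal hq hqr hK ?_)
    tauto
  have hsq : Squarefree r := by
    rw [Nat.squarefree_iff_prime_squarefree]
    intro q hq hqr
    rw [← pow_two] at hqr
    exact (hram q hq ((dvd_pow_self q two_ne_zero).trans hqr)).2 hqr
  refine ⟨r, ?_, K, hKc, hK⟩
  rw [Int.natCast_dvd]
  have hΔ0 : Δ.natAbs ≠ 0 := Int.natAbs_ne_zero.mpr h.delta_ne_zero
  rw [← Nat.prod_primeFactors_of_squarefree hsq]
  refine (Finset.prod_dvd_prod_of_subset _ _ _ ?_).trans (Nat.prod_primeFactors_dvd Δ.natAbs)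
  intro q hq
  rw [Nat.mem_primeFactors] at hq ⊢
  exact ⟨hq.1, Int.natCast_dvd.mp (hram q hq.1 hq.2.1).1, hΔ0⟩

/-- The ideals with squares `(D)` and `(E)`, where `DE = |Δ|`, have the same class. -/
theorem mk0_eq_of_mul_eq {D E : ℕ} (hDE : (D : ℤ) * E = -Δ) {𝔞 𝔟 : (Ideal (𝓞 F))⁰}
    (ha : IsRootIdeal F D 𝔞) (hb : IsRootIdeal F E 𝔟) :
    ClassGroup.mk0 𝔞 = ClassGroup.mk0 𝔟 := by
  have hE0 : (E : 𝓞 F) ≠ 0 := by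
    have : E ≠ 0 := by
      rintro rfl
      have := h.neg
      simp at hDE
      omega
    exact_mod_cast this
  have hs0 : s ≠ 0 := by
    rintro hs
    have := h.sq
    rw [hs, zero_pow two_ne_zero] at this
    exact h.delta_ne_zero (by exact_mod_cast this.symm)
  have hab : (𝔞 : Ideal (𝓞 F)) * 𝔟 = Ideal.span {s} := by
    refine ideal_eq_of_sq_eq ?_
    rw [mul_pow, ha, hb, Ideal.span_singleton_mul_span_singleton, Ideal.span_singleton_pow, h.sq,
      ← Ideal.span_singleton_neg (Δ : 𝓞 F)]
    congr 2
    exact_mod_cast congrArg (Int.cast : ℤ → 𝓞 F) hDE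
  refine mk0_eq_of_span_mul_eq hE0 hs0 ?_
  rw [← hab, ← hb]
  ring

/-- Every ideal class contains an ideal of norm prime to `m` which is not divisible by any
rational prime. -/
theorem exists_primitive_coprime (c : ClassGroup (𝓞 F)) {m : ℕ} (hm : 1 < m) :
    ∃ 𝔟 : (Ideal (𝓞 F))⁰, ClassGroup.mk0 𝔟 = c ∧
      (Ideal.absNorm (𝔟 : Ideal (𝓞 F))).Coprime m ∧
      ∀ q : ℕ, q.Prime → ¬ (𝔟 : Ideal (𝓞 F)) ≤ Ideal.span {(q : 𝓞 F)} := by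
  classical
  have hm0 : (m : 𝓞 F) ≠ 0 := by
    have : m ≠ 0 := by omega
    exact_mod_cast this
  have hex : ∃ N : ℕ, ∃ 𝔟 : (Ideal (𝓞 F))⁰, ClassGroup.mk0 𝔟 = c ∧
      (Ideal.absNorm (𝔟 : Ideal (𝓞 F))).Coprime m ∧ Ideal.absNorm (𝔟 : Ideal (𝓞 F)) = N := by
    obtain ⟨J, hJ⟩ := ClassGroup.mk0_surjective c⁻¹
    have hJ0 : (J : Ideal (𝓞 F)) ≠ 0 := nonZeroDivisors.coe_ne_zero J
    have hspan0 : Ideal.span {(m : 𝓞 F)} ≠ 0 := by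
      rwa [Ne, Ideal.zero_eq_bot, Ideal.span_singleton_eq_bot]
    -- With `J` in the inverse class and `J = mJ + (a)`, the cofactor `𝔟` in `(a) = J𝔟` is prime to
    -- `m`. An ideal of least norm among such `𝔟` is then primitive.
    obtain ⟨a, ha⟩ := IsDedekindDomain.exists_sup_span_eq
      (I := (J : Ideal (𝓞 F)) * Ideal.span {(m : 𝓞 F)}) (J := J) Ideal.mul_le_left
      (mul_ne_zero hJ0 hspan0)
    have haJ : a ∈ (J : Ideal (𝓞 F)) := by
      rw [← ha]
      exact Ideal.mem_sup_right (Ideal.mem_span_singleton_self a)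
    obtain ⟨𝔟, hb⟩ := Ideal.dvd_span_singleton.mpr haJ
    have hsup : Ideal.span {(m : 𝓞 F)} ⊔ 𝔟 = ⊤ := by
      rw [hb, ← Ideal.mul_sup] at ha
      refine mul_left_cancel₀ hJ0 (ha.trans ?_)
      rw [Ideal.mul_top]
    have hb0 : 𝔟 ≠ 0 := by
      rintro rfl
      rw [Ideal.zero_eq_bot, sup_bot_eq, Ideal.span_singleton_eq_top, isUnit_iff_dvd_one] at hsup
      have := h.natCast_dvd_natCast (a := m) (b := 1) (by simpa using hsup)
      rw [Nat.dvd_one] at this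
      omega
    have ha0 : a ≠ 0 := by
      rintro rfl
      rw [Ideal.span_singleton_eq_bot.mpr rfl] at hb
      exact mul_ne_zero hJ0 hb0 hb.symm
    refine ⟨_, ⟨𝔟, mem_nonZeroDivisors_of_ne_zero hb0⟩, ?_, ?_, rfl⟩
    · rw [← inv_inv c, ← hJ, ClassGroup.mk0_eq_mk0_inv_iff]
      exact ⟨a, ha0, by rw [hb, mul_comm]⟩
    · have h1 : (1 : 𝓞 F) ∈ Ideal.span {(m : 𝓞 F)} ⊔ 𝔟 := by
        rw [hsup]
        exact Submodule.mem_top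
      obtain ⟨u, hu, v, hv, huv⟩ := Submodule.mem_sup.mp h1
      obtain ⟨t, rfl⟩ := Ideal.mem_span_singleton.mp hu
      -- With `1 = m t + v` and `v ∈ 𝔟`, the norm of `v` is `1` modulo `m`, and it is a multiple of
      -- the norm of `𝔟`.
      obtain ⟨x, y, ht, htN⟩ := h.coords t
      have hvN := h.norm_of_coords (β := v) (x := 2 - m * x) (y := -(m * y)) (by
        push_cast
        linear_combination 2 * huv - m * ht)
      have hvN' : Algebra.norm ℤ v = 1 - m * (x - m * Algebra.norm ℤ t) := by
        linarith [show (2 - (m : ℤ) * x) ^ 2 - Δ * (-(m * y)) ^ 2 =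
          4 - 4 * (m * x) + m ^ 2 * (4 * Algebra.norm ℤ t) by rw [htN]; ring]
      have hdvd := Ideal.absNorm_dvd_norm_of_mem hv
      rw [← Nat.isCoprime_iff_coprime]
      refine IsCoprime.of_isCoprime_of_dvd_left ?_ hdvd
      exact ⟨1, x - m * Algebra.norm ℤ t, by rw [hvN']; ring⟩
  obtain ⟨𝔟, hbc, hbm, hbN⟩ := Nat.find_spec hex
  refine ⟨𝔟, hbc, hbm, fun q hq hle => ?_⟩
  obtain ⟨J, hJ, hJc⟩ := exists_of_le_span_natCast hq.ne_zero 𝔟 hle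
  have hN : Ideal.absNorm (𝔟 : Ideal (𝓞 F)) = q ^ 2 * Ideal.absNorm (J : Ideal (𝓞 F)) := by
    rw [hJ, map_mul, h.absNorm_span_natCast]
  have h1 : Nat.find hex ≤ Ideal.absNorm (J : Ideal (𝓞 F)) :=
    Nat.find_min' hex ⟨J, hJc.trans hbc, Nat.Coprime.coprime_dvd_left ⟨q ^ 2, by rw [hN]; ring⟩ hbm,
      rfl⟩
  have h2 : 1 < q ^ 2 := Nat.one_lt_pow two_ne_zero hq.one_lt
  have h3 : 0 < Ideal.absNorm (J : Ideal (𝓞 F)) := Ideal.absNorm_pos_of_nonZeroDivisors J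
  rw [← hbN, hN] at h1
  nlinarith

/-- An odd prime `q ∤ Δ` modulo which `Δ` is a square is the norm of an ideal. -/
theorem exists_absNorm_eq_prime {q : ℕ} (hq : q.Prime) (hq2 : q ≠ 2) (hqΔ : ¬ (q : ℤ) ∣ Δ)
    (hsq : IsSquare (Δ : ZMod q)) :
    ∃ 𝔮 : (Ideal (𝓞 F))⁰, Ideal.absNorm (𝔮 : Ideal (𝓞 F)) = q := by
  have hq' : Prime (q : ℤ) := Nat.prime_iff_prime_int.mp hq
  obtain ⟨r, hr1, hr2⟩ : ∃ r : ℤ, (q : ℤ) ∣ r ^ 2 - Δ ∧ ¬ (q : ℤ) ^ 2 ∣ r ^ 2 - Δ := by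
    obtain ⟨z, hz⟩ := hsq
    obtain ⟨r, rfl⟩ := ZMod.intCast_surjective z
    have hr : (q : ℤ) ∣ r ^ 2 - Δ := by
      rw [← ZMod.intCast_zmod_eq_zero_iff_dvd]
      push_cast
      rw [hz]
      ring
    -- Replacing `r` by `r + q` changes `r² - Δ` by `q (2r + q)`, which is not divisible by `q²`
    -- because `q ∤ 2r`.
    by_cases hcase : (q : ℤ) ^ 2 ∣ r ^ 2 - Δ
    · refine ⟨r + q, ?_, fun hcon => ?_⟩
      · rw [show (r + q) ^ 2 - Δ = (r ^ 2 - Δ) + q * (2 * r + q) by ring]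
        exact dvd_add hr (dvd_mul_right _ _)
      · have h1 : (q : ℤ) ^ 2 ∣ q ^ 2 + q * (2 * r) := by
          have := dvd_sub hcon hcase
          rwa [show (r + q) ^ 2 - Δ - (r ^ 2 - Δ) = (q : ℤ) ^ 2 + q * (2 * r) by ring] at this
        have h2 : (q : ℤ) ∣ 2 * r := by
          rw [dvd_add_right dvd_rfl, pow_two] at h1
          exact (mul_dvd_mul_iff_left hq'.ne_zero).mp h1
        rcases hq'.dvd_or_dvd h2 with h3 | h3
        · have : q ∣ 2 := by exact_mod_cast h3
          exact hq2 ((Nat.prime_dvd_prime_iff_eq hq Nat.prime_two).mp this)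
        · exact hqΔ (by
            have := dvd_sub (dvd_pow h3 two_ne_zero) hr
            rwa [sub_sub_cancel] at this)
    · exact ⟨r, hr, hcase⟩
  have hnorm : ∀ t : ℤ, Algebra.norm ℤ (s - t) = t ^ 2 - Δ := fun t => by
    have := h.norm_of_coords (β := s - t) (x := -2 * t) (y := 2) (by push_cast; ring)
    linarith
  set I : Ideal (𝓞 F) := Ideal.span {(q : 𝓞 F), s - r} with hI
  have hI0 : I ≠ 0 := by
    intro h0
    have : (q : 𝓞 F) ∈ I := Ideal.subset_span (by simp)
    rw [h0] at this
    have : (q : 𝓞 F) = 0 := by simpa using this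
    exact hq.ne_zero (by exact_mod_cast this)
  have h1 : Ideal.absNorm I ∣ q ^ 2 := by
    have := Ideal.absNorm_dvd_norm_of_mem (I := I) (x := (q : 𝓞 F)) (Ideal.subset_span (by simp))
    rw [h.norm_natCast] at this
    exact_mod_cast this
  have h2 : (Ideal.absNorm I : ℤ) ∣ r ^ 2 - Δ := by
    rw [← hnorm]
    exact Ideal.absNorm_dvd_norm_of_mem (Ideal.subset_span (by simp))
  have h3 : Ideal.absNorm I ≠ 1 := by
    rw [Ne, Ideal.absNorm_eq_one_iff, Ideal.eq_top_iff_one, hI, Ideal.mem_span_pair]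
    rintro ⟨a, b, hab⟩
    obtain ⟨k, hk⟩ := hr1
    have hk' : (r : 𝓞 F) ^ 2 - Δ = q * k := by exact_mod_cast congrArg (Int.cast : ℤ → 𝓞 F) hk
    -- Multiplying `a q + b (s - r) = 1` by `s + r` gives `q ∣ s + r`, whose norm `r² - Δ` is not
    -- divisible by `q²`.
    have hdvd : (q : 𝓞 F) ∣ s - (-r : ℤ) := by
      refine ⟨a * (s + r) - b * k, ?_⟩
      push_cast
      rw [← h.sq] at hk'
      linear_combination -(s + r) * hab - b * hk'
    have := map_dvd (Algebra.norm ℤ) hdvd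
    rw [h.norm_natCast, hnorm, neg_sq] at this
    exact hr2 this
  refine ⟨⟨I, mem_nonZeroDivisors_of_ne_zero hI0⟩, ?_⟩
  change Ideal.absNorm I = q
  obtain ⟨k, hk, hkI⟩ := (Nat.dvd_prime_pow hq).mp h1
  interval_cases k
  · simp at hkI
    exact absurd (by rw [hkI]; simp) h3
  · simpa using hkI
  · rw [hkI] at h2
    exact absurd (by exact_mod_cast h2) hr2

end IsQuadGen

/-! ### Genus characters -/

/-- Distinct primes, all `≡ 1 (mod 4)` except the last, which is `≡ 3 (mod 4)`. -/
structure IsPrimeTuple {n : ℕ} (p : Fin (n + 1) → ℕ) : Prop where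
  prime : ∀ i, (p i).Prime
  inj : Function.Injective p
  one : ∀ i : Fin n, p i.castSucc % 4 = 1
  three : p (Fin.last n) % 4 = 3

/-- The Hilbert symbol `(a, b / l)` of two integers, with value `1` if `l` is not prime. -/
def localSym (l : ℕ) (a b : ℤ) : ℤˣ :=
  if hl : l.Prime then haveI : Fact l.Prime := ⟨hl⟩; hilbertSym l (a : ℚ_[l]) (b : ℚ_[l]) else 1

theorem localSym_eq (l : ℕ) [hl : Fact l.Prime] (a b : ℤ) :
    localSym l a b = hilbertSym l (a : ℚ_[l]) (b : ℚ_[l]) := dif_pos hl.out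

theorem hilbertSymProd_eq_prod (D : ℕ) (a b : ℤ) :
    hilbertSymProd D a b = ∏ l ∈ D.primeFactors, localSym l a b := by
  rw [← Finset.prod_attach, hilbertSymProd]
  refine Finset.prod_congr rfl fun l _ => ?_
  have : Fact (l : ℕ).Prime := ⟨Nat.prime_of_mem_primeFactors l.2⟩
  rw [localSym_eq]

theorem exists_coprime_jacobiSym_eq {l : ℕ} (hl : l.Prime) (hl2 : l ≠ 2) (ε : ℤˣ) :
    ∃ a : ℕ, a.Coprime l ∧ jacobiSym a l = ε := by
  have : Fact l.Prime := ⟨hl⟩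
  rcases Int.units_eq_one_or ε with rfl | rfl
  · exact ⟨1, Nat.coprime_one_left l, by simp⟩
  · obtain ⟨b, hb⟩ := quadraticChar_exists_neg_one (F := ZMod l) (by rwa [ZMod.ringChar_zmod_n])
    have hJ : jacobiSym (b.val : ℤ) l = -1 := by
      rw [← jacobiSym.legendreSym.to_jacobiSym, legendreSym]
      simpa using hb
    refine ⟨b.val, ?_, by simpa using hJ⟩
    by_contra hcon
    have h0 : jacobiSym (b.val : ℤ) l = 0 := jacobiSym.eq_zero_iff.mpr ⟨hl.ne_zero, by
      rwa [Int.gcd_natCast_natCast]⟩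
    omega

namespace IsPrimeTuple

variable {n : ℕ} {p : Fin (n + 1) → ℕ} (hp : IsPrimeTuple p)
include hp

theorem odd (i : Fin (n + 1)) : Odd (p i) := by
  rw [Nat.odd_iff]
  refine Fin.lastCases ?_ (fun i => ?_) i
  · have := hp.three
    omega
  · have := hp.one i
    omega

theorem ne_two (i : Fin (n + 1)) : p i ≠ 2 := by
  intro h2
  have := hp.odd i
  rw [h2] at this
  exact absurd this (by decide)

theorem coprime {i j : Fin (n + 1)} (hij : i ≠ j) : (p i).Coprime (p j) :=
  (Nat.coprime_primes (hp.prime i) (hp.prime j)).mpr (hp.inj.ne hij)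

theorem disc_neg : disc p < 0 := by
  rw [disc, neg_lt_zero]
  exact Finset.prod_pos fun i _ => by exact_mod_cast (hp.prime i).pos

theorem disc_mod_four : disc p % 4 = 1 := by
  have h1 : ∀ S : Finset (Fin n), (∏ i ∈ S, (p i.castSucc : ℤ)) % 4 = 1 := by
    intro S
    induction S using Finset.cons_induction with
    | empty => rfl
    | cons a S ha ih =>
      rw [Finset.prod_cons, Int.mul_emod, ih]
      have := hp.one a
      omega
  have h2 := h1 Finset.univ
  have h3 := hp.three
  rw [disc, Fin.prod_univ_castSucc]
  have h4 : ((p (Fin.last n) : ℕ) : ℤ) % 4 = 3 := by omega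
  have h5 : ((∏ i : Fin n, (p i.castSucc : ℤ)) * (p (Fin.last n) : ℤ)) % 4 = 3 := by
    rw [Int.mul_emod, h2, h4]
    rfl
  omega

theorem disc_squarefree : Squarefree (disc p) := by
  rw [disc, ← Int.squarefree_natAbs, Int.natAbs_neg, ← Nat.cast_prod, Int.natAbs_natCast]
  refine Finset.squarefree_prod_of_pairwise_isCoprime ?_ fun i _ => (hp.prime i).squarefree
  intro i _ j _ hij
  exact Nat.coprime_iff_isRelPrime.mp (hp.coprime hij)

theorem exists_disc_eq_mul (i : Fin (n + 1)) :
    ∃ u : ℤ, disc p = (p i : ℤ) * u ∧ ¬ (p i : ℤ) ∣ u := by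
  obtain ⟨u, hu⟩ : (p i : ℤ) ∣ disc p :=
    (Finset.dvd_prod_of_mem (fun i => (p i : ℤ)) (Finset.mem_univ i)).neg_right
  refine ⟨u, hu, fun ⟨v, hv⟩ => ?_⟩
  have h1 := hp.disc_squarefree (p i) ⟨v, by rw [hu, hv]; ring⟩
  exact (Nat.prime_iff_prime_int.mp (hp.prime i)).not_isUnit h1

theorem localSym_mul (i : Fin (n + 1)) {a b : ℤ} (ha : a ≠ 0) (hb : b ≠ 0) :
    localSym (p i) (a * b) (disc p) = localSym (p i) a (disc p) * localSym (p i) b (disc p) := by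
  have : Fact (p i).Prime := ⟨hp.prime i⟩
  obtain ⟨u, hu, hpu⟩ := hp.exists_disc_eq_mul i
  rw [localSym_eq, localSym_eq, localSym_eq, hu, Int.cast_mul,
    hilbertSym_mul (hp.ne_two i) hpu (by exact_mod_cast ha) (by exact_mod_cast hb)]

theorem localSym_eq_jacobiSym (i : Fin (n + 1)) {v : ℤ} (hv : ¬ (p i : ℤ) ∣ v) :
    (localSym (p i) v (disc p) : ℤ) = jacobiSym v (p i) := by
  have : Fact (p i).Prime := ⟨hp.prime i⟩
  obtain ⟨u, hu, hpu⟩ := hp.exists_disc_eq_mul i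
  rw [localSym_eq, hu, hilbertSym_eq_legendreSym (hp.ne_two i) hpu hv,
    jacobiSym.legendreSym.to_jacobiSym]

theorem localSym_eq_one_of_norm (i : Fin (n + 1)) {a x y : ℤ} (ha : a ≠ 0)
    (h : 4 * a = x ^ 2 - disc p * y ^ 2) : localSym (p i) a (disc p) = 1 := by
  have : Fact (p i).Prime := ⟨hp.prime i⟩
  rw [localSym_eq, hilbertSym_eq_one_iff (by exact_mod_cast ha) (by exact_mod_cast hp.disc_neg.ne)]
  refine ⟨x / 2, y / 2, ?_⟩
  have h' : (4 : ℚ_[p i]) * a = x ^ 2 - disc p * y ^ 2 := by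
    exact_mod_cast congrArg (Int.cast : ℤ → ℚ_[p i]) h
  linear_combination h' / 4

end IsPrimeTuple

section GenusChar

variable {F : Type*} [Field F] [NumberField F] {n : ℕ} {p : Fin (n + 1) → ℕ} {s : 𝓞 F}

/-- Equivalent ideals have norms differing by norms of elements, and these are local norms
everywhere. -/
theorem localSym_absNorm_eq_of_mk0_eq (hp : IsPrimeTuple p) (h : IsQuadGen (disc p) s)
    (i : Fin (n + 1)) {I J : (Ideal (𝓞 F))⁰} (hIJ : ClassGroup.mk0 I = ClassGroup.mk0 J) :
    localSym (p i) (Ideal.absNorm (I : Ideal (𝓞 F))) (disc p) =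
      localSym (p i) (Ideal.absNorm (J : Ideal (𝓞 F))) (disc p) := by
  obtain ⟨x, y, hx, hy, hxy⟩ := ClassGroup.mk0_eq_mk0_iff.mp hIJ
  have hnorm : ∀ z : 𝓞 F, z ≠ 0 → Algebra.norm ℤ z ≠ 0 ∧
      localSym (p i) (Algebra.norm ℤ z) (disc p) = 1 := by
    intro z hz
    have hz0 : Algebra.norm ℤ z ≠ 0 := Algebra.norm_ne_zero_iff.mpr hz
    obtain ⟨u, v, -, huv⟩ := h.coords z
    exact ⟨hz0, hp.localSym_eq_one_of_norm i hz0 huv⟩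
  have habs : ∀ K : (Ideal (𝓞 F))⁰, (Ideal.absNorm (K : Ideal (𝓞 F)) : ℤ) ≠ 0 := fun K => by
    exact_mod_cast (Ideal.absNorm_pos_of_nonZeroDivisors K).ne'
  have key := congrArg (fun K => (Ideal.absNorm K : ℤ)) hxy
  simp only [map_mul, Nat.cast_mul, h.absNorm_span] at key
  have key2 := congrArg (fun a => localSym (p i) a (disc p)) key
  rwa [hp.localSym_mul i (hnorm x hx).1 (habs I), hp.localSym_mul i (hnorm y hy).1 (habs J),
    (hnorm x hx).2, (hnorm y hy).2, one_mul, one_mul] at key2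

/-- The genus character at the prime `p i` of the class group. -/
def genusChar (hp : IsPrimeTuple p) (h : IsQuadGen (disc p) s) (i : Fin (n + 1)) :
    ClassGroup (𝓞 F) →* ℤˣ :=
  MonoidHom.mk' (fun c => localSym (p i)
    (Ideal.absNorm ((ClassGroup.mk0_surjective c).choose : Ideal (𝓞 F))) (disc p)) (by
    intro c d
    have hc := (ClassGroup.mk0_surjective c).choose_spec
    have hd := (ClassGroup.mk0_surjective d).choose_spec
    have hcd := (ClassGroup.mk0_surjective (c * d)).choose_spec
    rw [← hp.localSym_mul i (by exact_mod_cast (Ideal.absNorm_pos_of_nonZeroDivisors _).ne')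
      (by exact_mod_cast (Ideal.absNorm_pos_of_nonZeroDivisors _).ne'), ← Nat.cast_mul, ← map_mul]
    exact localSym_absNorm_eq_of_mk0_eq hp h i
      (J := (ClassGroup.mk0_surjective c).choose * (ClassGroup.mk0_surjective d).choose)
      (by rw [hcd, map_mul, hc, hd]))

theorem genusChar_mk0 (hp : IsPrimeTuple p) (h : IsQuadGen (disc p) s) (i : Fin (n + 1))
    (I : (Ideal (𝓞 F))⁰) : genusChar hp h i (ClassGroup.mk0 I) =
      localSym (p i) (Ideal.absNorm (I : Ideal (𝓞 F))) (disc p) :=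
  localSym_absNorm_eq_of_mk0_eq hp h i (ClassGroup.mk0_surjective (ClassGroup.mk0 I)).choose_spec

theorem genusChar_isRootIdeal_symm (hp : IsPrimeTuple p) (h : IsQuadGen (disc p) s) {i j : Fin n}
    {𝔞 𝔟 : (Ideal (𝓞 F))⁰} (ha : IsRootIdeal F (p i.castSucc) 𝔞)
    (hb : IsRootIdeal F (p j.castSucc) 𝔟) :
    genusChar hp h j.castSucc (ClassGroup.mk0 𝔞) = genusChar hp h i.castSucc (ClassGroup.mk0 𝔟) := by
  rw [genusChar_mk0, genusChar_mk0, h.absNorm_of_isRootIdeal ha, h.absNorm_of_isRootIdeal hb]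
  by_cases hij : i = j
  · subst hij
    rfl
  have hndvd : ∀ k l : Fin n, k ≠ l → ¬ ((p k.castSucc : ℕ) : ℤ) ∣ (p l.castSucc : ℕ) := by
    intro k l hkl hdvd
    have h1 : p k.castSucc ∣ p l.castSucc := by exact_mod_cast hdvd
    have h2 := (Nat.prime_dvd_prime_iff_eq (hp.prime _) (hp.prime _)).mp h1
    exact hkl (Fin.castSucc_injective n (hp.inj h2))
  apply Units.ext
  rw [hp.localSym_eq_jacobiSym _ (hndvd j i (Ne.symm hij)),
    hp.localSym_eq_jacobiSym _ (hndvd i j hij)]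
  exact jacobiSym.quadratic_reciprocity_one_mod_four (hp.one i) (hp.odd _)

/-- By Dirichlet's theorem the genus characters at the primes `≡ 1 (mod 4)` are independent. -/
theorem exists_genusChar_eq (hp : IsPrimeTuple p) (h : IsQuadGen (disc p) s) (ε : Fin n → ℤˣ) :
    ∃ c : ClassGroup (𝓞 F), ∀ i : Fin n, genusChar hp h i.castSucc c = ε i := by
  -- The sign at the last prime is chosen to make the total product `1`, which forces `(Δ/q) = 1`
  -- for the prime `q` found below.
  let ε' : Fin (n + 1) → ℤˣ := Fin.snoc ε (∏ i, ε i)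
  have hε' : ∏ i, ε' i = 1 := by
    rw [Fin.prod_univ_castSucc]
    simp only [ε', Fin.snoc_castSucc, Fin.snoc_last]
    exact Int.units_mul_self _
  choose a ha hJ using fun i => exists_coprime_jacobiSym_eq (hp.prime i) (hp.ne_two i) (ε' i)
  -- The index `none` carries the extra congruence `q ≡ 1 (mod 4)`, which lets reciprocity hold
  -- without signs, even at the last prime, and gives `(-1/q) = 1`.
  let m : Option (Fin (n + 1)) → ℕ := fun o => o.elim 4 p
  let b : Option (Fin (n + 1)) → ℕ := fun o => o.elim 1 a
  have hm0 : ∀ o, m o ≠ 0 := by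
    rintro (_ | i)
    · exact four_ne_zero
    · exact (hp.prime i).ne_zero
  have h4 : ∀ i, Nat.Coprime 4 (p i) := fun i => by
    rw [show 4 = 2 ^ 2 by rfl]
    exact ((Nat.coprime_primes Nat.prime_two (hp.prime i)).mpr (hp.ne_two i).symm).pow_left 2
  have hco : Set.Pairwise (Finset.univ : Finset (Option (Fin (n + 1))))
      (Function.onFun Nat.Coprime m) := by
    rintro (_ | i) - (_ | j) - hij
    · exact absurd rfl hij
    · exact h4 j
    · exact (h4 i).symm
    · exact hp.coprime fun e => hij (by rw [e])
  obtain ⟨k, hk⟩ := Nat.chineseRemainderOfFinset b m Finset.univ (fun o _ => hm0 o) hco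
  have hkb : ∀ o, k ≡ b o [MOD m o] := fun o => hk o (Finset.mem_univ o)
  have hkM : k.Coprime (∏ o, m o) := by
    refine Nat.Coprime.prod_right ?_
    rintro (_ | i) -
    · exact (hkb none).gcd_eq.trans (Nat.gcd_one_left 4)
    · exact (hkb (some i)).gcd_eq.trans (ha i)
  obtain ⟨q, hqgt, hq, hqk⟩ := Nat.forall_exists_prime_gt_and_modEq
    (2 + ∏ i, p i) (Finset.prod_ne_zero_iff.mpr fun o _ => hm0 o) hkM
  have hqm : ∀ o, q ≡ b o [MOD m o] := fun o =>
    (hqk.of_dvd (Finset.dvd_prod_of_mem m (Finset.mem_univ o))).trans (hkb o)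
  have hq4 : q % 4 = 1 := hqm none
  have hqJ : ∀ i, jacobiSym q (p i) = ε' i := fun i => by
    rw [← hJ i]
    refine jacobiSym.mod_left' ?_
    exact_mod_cast hqm (some i)
  have hPpos : 0 < ∏ i, p i := Finset.prod_pos fun i _ => (hp.prime i).pos
  have hqΔ : ¬ (q : ℤ) ∣ disc p := by
    intro hdvd
    rw [disc, dvd_neg, ← Nat.cast_prod, Int.natCast_dvd_natCast] at hdvd
    have := Nat.le_of_dvd hPpos hdvd
    omega
  have hqodd : Odd q := Nat.odd_iff.mpr (by omega)
  have : Fact q.Prime := ⟨hq⟩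
  have hJΔ : jacobiSym (disc p) q = 1 := by
    have hprod : ∀ S : Finset (Fin (n + 1)),
        jacobiSym (∏ i ∈ S, (p i : ℤ)) q = ∏ i ∈ S, (ε' i : ℤ) := by
      intro S
      induction S using Finset.cons_induction with
      | empty => simp
      | cons i S hi ih =>
        rw [Finset.prod_cons, Finset.prod_cons, jacobiSym.mul_left, ih, ← hqJ i,
          jacobiSym.quadratic_reciprocity_one_mod_four' (hp.odd i) hq4]
    rw [disc, ← neg_one_mul, jacobiSym.mul_left, hprod, jacobiSym.at_neg_one hqodd,
      ZMod.χ₄_nat_one_mod_four hq4, one_mul]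
    rw [← Units.coe_prod, hε', Units.val_one]
  obtain ⟨𝔮, h𝔮⟩ := h.exists_absNorm_eq_prime hq (by omega) hqΔ
    (ZMod.isSquare_of_jacobiSym_eq_one hJΔ)
  refine ⟨ClassGroup.mk0 𝔮, fun i => ?_⟩
  have hndvd : ¬ (p i.castSucc : ℤ) ∣ (q : ℤ) := by
    intro hdvd
    have h1 : p i.castSucc ∣ q := by exact_mod_cast hdvd
    have h2 := (Nat.prime_dvd_prime_iff_eq (hp.prime _) hq).mp h1
    have h3 : p i.castSucc ≤ ∏ i, p i :=
      Nat.le_of_dvd hPpos (Finset.dvd_prod_of_mem p (Finset.mem_univ _))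
    omega
  rw [genusChar_mk0, h𝔮]
  apply Units.ext
  rw [hp.localSym_eq_jacobiSym _ hndvd, hqJ]
  simp only [ε', Fin.snoc_castSucc]

end GenusChar

/-! ### Quartic residue symbols -/

theorem jacobiSym_prod_right (a : ℤ) (S : Finset ℕ) (hS : ∀ q ∈ S, q ≠ 0) :
    jacobiSym a (∏ q ∈ S, q) = ∏ q ∈ S, jacobiSym a q := by
  induction S using Finset.cons_induction with
  | empty => simp
  | cons q S hq ih =>
    have hS' : ∀ r ∈ S, r ≠ 0 := fun r hr => hS r (Finset.mem_cons_of_mem hr)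
    rw [Finset.prod_cons, Finset.prod_cons, jacobiSym.mul_right' _ (hS q (Finset.mem_cons_self q S))
      (Finset.prod_ne_zero_iff.mpr hS'), ih hS']

theorem jacobiSym_eq_prod_primeFactors (a : ℤ) {D : ℕ} (hD : Squarefree D) :
    jacobiSym a D = ∏ q ∈ D.primeFactors, jacobiSym a q := by
  rw [← jacobiSym_prod_right a _ fun q hq => (Nat.prime_of_mem_primeFactors hq).ne_zero,
    Nat.prod_primeFactors_of_squarefree hD]

theorem odd_sq_emod_eight {a : ℤ} (ha : a % 2 = 1) : a ^ 2 % 8 = 1 := by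
  have : a % 8 = 1 ∨ a % 8 = 3 ∨ a % 8 = 5 ∨ a % 8 = 7 := by omega
  rcases this with h | h | h | h <;> simp [pow_two, Int.mul_emod, h]

/-! ### The equation `4N² = D z² - e y²`. -/

section Equation

variable {D N : ℕ} {e y z : ℤ}

/-- Let `2^k` divide `y` exactly. The case `k = 1` is impossible modulo `4`, and for `k = 2` the
symbol is squared. If `k ≥ 3`, halving `y` and `z` leaves `D z² ≡ N² (mod 8)` with `z` and `N` odd,
so `D ≡ 1 (mod 8)`. -/
theorem jacobiSym_two_pow_eq_one (hD : D % 4 = 1) (he : e % 4 = 1) (hN : Odd N)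
    (heq : 4 * (N : ℤ) ^ 2 = D * z ^ 2 - e * y ^ 2) (hzy : z % 2 = y % 2) {k : ℕ}
    (hk : (2 : ℤ) ^ k ∣ y) (hk' : ¬ (2 : ℤ) ^ (k + 1) ∣ y) : jacobiSym 2 D ^ k = 1 := by
  have hDodd : Odd D := Nat.odd_iff.mpr (by omega)
  rcases Nat.eq_zero_or_pos k with rfl | hk0
  · exact pow_zero _
  obtain ⟨y', rfl⟩ : (2 : ℤ) ∣ y := (dvd_pow_self 2 hk0.ne').trans hk
  obtain ⟨z', rfl⟩ : (2 : ℤ) ∣ z := by omega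
  have heq' : (N : ℤ) ^ 2 = D * z' ^ 2 - e * y' ^ 2 := by linarith
  have hN8 : (N : ℤ) ^ 2 % 8 = 1 := odd_sq_emod_eight (by have := Nat.odd_iff.mp hN; omega)
  have hy' : y' % 2 = 0 := by
    by_contra hcon
    have hy8 : y' ^ 2 % 8 = 1 := odd_sq_emod_eight (by omega)
    have hz8 : z' ^ 2 % 4 = 0 ∨ z' ^ 2 % 4 = 1 := by
      rcases Int.emod_two_eq_zero_or_one z' with h | h
      · obtain ⟨w, rfl⟩ : (2 : ℤ) ∣ z' := by omega
        left
        rw [mul_pow]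
        omega
      · right
        have := odd_sq_emod_eight h
        omega
    have h1 : e * y' ^ 2 % 4 = 1 := by
      rw [Int.mul_emod, he, show y' ^ 2 % 4 = 1 by omega]
      rfl
    have h2 : (D : ℤ) * z' ^ 2 % 4 = z' ^ 2 % 4 := by
      rw [Int.mul_emod, show (D : ℤ) % 4 = 1 by omega]
      omega
    omega
  obtain ⟨w, rfl⟩ : (2 : ℤ) ∣ y' := by omega
  have hz' : z' % 2 = 1 := by
    by_contra hcon
    obtain ⟨v, rfl⟩ : (2 : ℤ) ∣ z' := by omega
    have : (N : ℤ) ^ 2 = 4 * (D * v ^ 2 - e * w ^ 2) := by linarith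
    omega
  have hz8 := odd_sq_emod_eight hz'
  by_cases hw : w % 2 = 0
  · obtain ⟨v, rfl⟩ : (2 : ℤ) ∣ w := by omega
    have h1 : (D : ℤ) * z' ^ 2 = N ^ 2 + 8 * (2 * e * v ^ 2) := by linarith
    have h2 : (D : ℤ) * z' ^ 2 % 8 = D % 8 := by
      rw [Int.mul_emod, hz8]
      omega
    have h3 : D % 8 = 1 := by omega
    rw [jacobiSym.at_two hDodd, ZMod.χ₈_nat_eq_if_mod_eight, h3]
    simp [show D % 2 ≠ 0 by omega]
  · have hk2 : k = 2 := by
      have h1 : 2 ≤ k := by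
        by_contra hlt
        have : k = 1 := by omega
        subst this
        exact hk' ⟨w, by ring⟩
      by_contra hne
      have h3 : (2 : ℤ) ^ 3 ∣ 2 * (2 * w) := (pow_dvd_pow 2 (by omega)).trans hk
      obtain ⟨v, hv⟩ := h3
      omega
    subst hk2
    refine jacobiSym.sq_one ?_
    have : Nat.Coprime 2 D := (Nat.coprime_two_left).mpr hDodd
    exact_mod_cast this

/-- Write `y = ± 2^k o` with `o` odd. The sign is harmless since `D ≡ 1 (mod 4)`, and `(o/D) =
(D/o)` by reciprocity. At a prime `q ∣ o` the equation reads `(2N)² ≡ D z²` with `2N` invertible, so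
`D` is a nonzero square modulo `q`. -/
theorem jacobiSym_eq_one_of_eq (hD : D % 4 = 1) (he : e % 4 = 1) (hN : Odd N)
    (heq : 4 * (N : ℤ) ^ 2 = D * z ^ 2 - e * y ^ 2) (hzy : z % 2 = y % 2)
    (hcop : ∀ q : ℕ, q.Prime → q ≠ 2 → (q : ℤ) ∣ y → ¬ q ∣ N) : jacobiSym y D = 1 := by
  have hDodd : Odd D := Nat.odd_iff.mpr (by omega)
  have hdiv : ∀ q : ℕ, q.Prime → q ≠ 2 → (q : ℤ) ∣ y → ¬ (q : ℤ) ∣ 2 * N := by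
    intro q hq hq2 hqy hdvd
    rcases (Nat.prime_iff_prime_int.mp hq).dvd_or_dvd hdvd with h | h
    · have : q ∣ 2 := by exact_mod_cast h
      exact hq2 ((Nat.prime_dvd_prime_iff_eq hq Nat.prime_two).mp this)
    · exact hcop q hq hq2 hqy (by exact_mod_cast h)
  have hyD : ∀ q : ℕ, q.Prime → q ∣ D → ¬ (q : ℤ) ∣ y := by
    intro q hq hqD hqy
    have hq2 : q ≠ 2 := by
      rintro rfl
      omega
    refine hdiv q hq hq2 hqy ((Nat.prime_iff_prime_int.mp hq).dvd_of_dvd_pow (n := 2) ?_)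
    rw [mul_pow, show (2 : ℤ) ^ 2 = 4 by norm_num, heq]
    have hqD' : (q : ℤ) ∣ D := by exact_mod_cast hqD
    exact dvd_sub (dvd_mul_of_dvd_left hqD' _)
      (dvd_mul_of_dvd_right (dvd_pow hqy two_ne_zero) _)
  by_cases hD1 : D = 1
  · rw [hD1, jacobiSym.one_right]
  have hy0 : y ≠ 0 := by
    rintro rfl
    exact hyD _ (Nat.minFac_prime hD1) (Nat.minFac_dvd D) (dvd_zero _)
  obtain ⟨k, o, hodd, hko⟩ := Nat.exists_eq_two_pow_mul_odd (Int.natAbs_ne_zero.mpr hy0)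
  have hoy : (o : ℤ) ∣ y := by
    rw [Int.natCast_dvd, hko]
    exact dvd_mul_left _ _
  have hneg : jacobiSym (-1) D = 1 := by
    rw [jacobiSym.at_neg_one hDodd, ZMod.χ₄_nat_one_mod_four hD]
  have habs : jacobiSym y D = jacobiSym (y.natAbs : ℤ) D := by
    rcases Int.natAbs_eq y with h | h
    · rw [← h]
    · conv_lhs => rw [h, ← neg_one_mul, jacobiSym.mul_left, hneg, one_mul]
  have htwo : jacobiSym 2 D ^ k = 1 := by
    refine jacobiSym_two_pow_eq_one hD he hN heq hzy ?_ ?_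
    · rw [← Int.dvd_natAbs, hko]
      exact ⟨o, by push_cast; ring⟩
    · rw [← Int.dvd_natAbs, hko]
      intro hdvd
      have h1 : 2 ^ (k + 1) ∣ 2 ^ k * o := by exact_mod_cast hdvd
      rw [pow_succ] at h1
      have h2 : 2 ∣ o := (Nat.mul_dvd_mul_iff_left (by positivity)).mp h1
      rw [Nat.odd_iff] at hodd
      omega
  have hoD : jacobiSym (D : ℤ) o = 1 := by
    rcases jacobiSym.trichotomy (D : ℤ) o with h | h | h
    · exfalso
      have h1 := (jacobiSym.eq_zero_iff.mp h).2
      rw [Int.gcd_natCast_natCast] at h1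
      obtain ⟨q, hq, hqD, hqo⟩ := Nat.Prime.not_coprime_iff_dvd.mp h1
      exact hyD q hq hqD (dvd_trans (by exact_mod_cast hqo) hoy)
    · exact h
    · exfalso
      obtain ⟨q, hq, hqo, hqJ⟩ := jacobiSym.eq_neg_one_at_prime_divisor_of_eq_neg_one h
      have : Fact q.Prime := ⟨hq⟩
      have hqy : (q : ℤ) ∣ y := dvd_trans (by exact_mod_cast hqo) hoy
      have hq2 : q ≠ 2 := by
        rintro rfl
        rw [Nat.odd_iff] at hodd
        omega
      refine hdiv q hq hq2 hqy (jacobiSym.prime_dvd_of_eq_neg_one hqJ (x := 2 * N) (y := z) ?_).1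
      rw [show (2 * (N : ℤ)) ^ 2 - D * z ^ 2 = -(e * y ^ 2) by rw [mul_pow]; linarith]
      exact (dvd_mul_of_dvd_right (dvd_pow hqy two_ne_zero) _).neg_right
  rw [habs, hko]
  push_cast
  rw [jacobiSym.mul_left, jacobiSym.pow_left, htwo, one_mul,
    ← jacobiSym.quadratic_reciprocity_one_mod_four hD hodd, hoD]

/-- With `q = 4k + 1`, raise `4N² ≡ -e y²` to the power `k`. The squares become the Legendre symbols
of `2`, `N` and `y`, and the sign `(-1)^k` cancels `(2/q)`. -/
theorem quarticSym_eq_of_dvd {q : ℕ} (hq : q.Prime) (hq4 : q % 4 = 1)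
    (hdvd : (q : ℤ) ∣ 4 * (N : ℤ) ^ 2 + e * y ^ 2) (hqN : ¬ q ∣ N) :
    (quarticSym e q : ℤ) = jacobiSym N q * jacobiSym y q := by
  have : Fact q.Prime := ⟨hq⟩
  obtain ⟨k, hk⟩ : ∃ k, q = 4 * k + 1 := ⟨q / 4, by omega⟩
  have hqodd : Odd q := Nat.odd_iff.mpr (by omega)
  have hqN' : ¬ (q : ℤ) ∣ (N : ℤ) := by exact_mod_cast hqN
  have hqp := Nat.prime_iff_prime_int.mp hq
  have hqy : ¬ (q : ℤ) ∣ y := by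
    intro hy
    have h1 : (q : ℤ) ∣ 4 * (N : ℤ) ^ 2 :=
      (dvd_add_left (dvd_mul_of_dvd_right (dvd_pow hy two_ne_zero) _)).mp hdvd
    rcases hqp.dvd_or_dvd h1 with h2 | h2
    · have h3 : q ∣ 4 := by exact_mod_cast h2
      have h4 := Nat.le_of_dvd (by norm_num) h3
      have h5 := hq.two_le
      omega
    · exact hqN' (hqp.dvd_of_dvd_pow h2)
  have hunit : ∀ a : ℤ, ¬ (q : ℤ) ∣ a → jacobiSym a q = 1 ∨ jacobiSym a q = -1 := by
    intro a ha
    refine jacobiSym.eq_one_or_neg_one ?_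
    rw [← Int.isCoprime_iff_gcd_eq_one, isCoprime_comm]
    exact (hqp.coprime_iff_not_dvd).mpr ha
  have hpow : ∀ a : ℤ, ((jacobiSym a q : ℤ) : ZMod q) = (a : ZMod q) ^ (2 * k) := by
    intro a
    rw [← jacobiSym.legendreSym.to_jacobiSym, legendreSym.eq_pow]
    congr 1
    omega
  have h2 : jacobiSym 2 q = (-1) ^ k := by
    rw [jacobiSym.at_two hqodd, ZMod.χ₈_nat_eq_if_mod_eight]
    rcases Nat.even_or_odd k with h | h
    · rw [h.neg_one_pow]
      obtain ⟨j, hj⟩ := h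
      rw [if_neg (by omega), if_pos (by omega)]
    · rw [h.neg_one_pow]
      obtain ⟨j, hj⟩ := h
      rw [if_neg (by omega), if_neg (by omega)]
  have hZ : (4 : ZMod q) * (N : ZMod q) ^ 2 = -1 * e * (y : ZMod q) ^ 2 := by
    have := (ZMod.intCast_zmod_eq_zero_iff_dvd _ q).mpr hdvd
    push_cast at this
    linear_combination this
  have hZk := congrArg (· ^ k) hZ
  simp only [mul_pow, ← pow_mul] at hZk
  have hN2 := hpow N
  have hy2 := hpow y
  have h22 := hpow 2
  rw [h2] at h22
  push_cast at hN2 hy2 h22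
  rw [show (4 : ZMod q) = 2 ^ 2 by norm_num, ← pow_mul, ← h22, ← hN2, ← hy2, mul_assoc] at hZk
  have hcan := mul_left_cancel₀ (pow_ne_zero k (neg_ne_zero.mpr one_ne_zero)) hZk
  have hke : (e : ZMod q) ^ k = ((jacobiSym N q * jacobiSym y q : ℤ) : ZMod q) := by
    push_cast
    rcases hunit y hqy with h | h <;> rw [h] at hcan ⊢ <;> rw [hcan] <;> push_cast <;> ring
  have hk4 : (q - 1) / 4 = k := by omega
  rw [quarticSym, hk4, hke]
  have h1ne : (-1 : ZMod q) ≠ 1 := by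
    have : Fact (2 < q) := ⟨by have := hq.two_le; omega⟩
    exact ZMod.neg_one_ne_one
  rcases hunit N hqN' with h | h <;> rcases hunit y hqy with h' | h' <;> rw [h, h'] <;>
    simp [h1ne]

end Equation

theorem natCast_dvd_disc {n : ℕ} {p : Fin (n + 1) → ℕ} {D : ℕ}
    (hD : D ∣ ∏ i : Fin n, p i.castSucc) : (D : ℤ) ∣ disc p := by
  rw [disc, dvd_neg, Fin.prod_univ_castSucc]
  refine dvd_mul_of_dvd_left ?_ _
  exact_mod_cast hD

namespace IsPrimeTuple

variable {n : ℕ} {p : Fin (n + 1) → ℕ} (hp : IsPrimeTuple p)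
include hp

theorem exists_eq_of_prime_dvd {D q : ℕ} (hD : D ∣ ∏ i : Fin n, p i.castSucc) (hq : q.Prime)
    (hqD : q ∣ D) : ∃ i : Fin n, q = p i.castSucc := by
  obtain ⟨i, -, hi⟩ := (hq.prime.dvd_finsetProd_iff _).mp (hqD.trans hD)
  exact ⟨i, (Nat.prime_dvd_prime_iff_eq hq (hp.prime _)).mp hi⟩

theorem squarefree_of_dvd {D : ℕ} (hD : D ∣ ∏ i : Fin n, p i.castSucc) : Squarefree D := by
  rw [← Int.squarefree_natCast]
  exact hp.disc_squarefree.squarefree_of_dvd (natCast_dvd_disc hD)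

theorem mod_four_of_dvd {D : ℕ} (hD : D ∣ ∏ i : Fin n, p i.castSucc) : D % 4 = 1 := by
  have h1 : ∀ S : Finset ℕ, (∀ q ∈ S, q % 4 = 1) → (∏ q ∈ S, q) % 4 = 1 := by
    intro S
    induction S using Finset.cons_induction with
    | empty => simp
    | cons a S ha ih =>
      intro hS
      rw [Finset.prod_cons, Nat.mul_mod, hS a (Finset.mem_cons_self a S),
        ih fun q hq => hS q (Finset.mem_cons_of_mem hq)]
  rw [← Nat.prod_primeFactors_of_squarefree (hp.squarefree_of_dvd hD)]
  refine h1 _ fun q hq => ?_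
  obtain ⟨i, rfl⟩ := hp.exists_eq_of_prime_dvd hD (Nat.prime_of_mem_primeFactors hq)
    (Nat.dvd_of_mem_primeFactors hq)
  exact hp.one i

end IsPrimeTuple

/-! ### Evaluation of `χ_D` at a square root of the class of `D`. -/

section Quartic

variable {F : Type*} [Field F] [NumberField F] {n : ℕ} {p : Fin (n + 1) → ℕ} {s : 𝓞 F}

theorem chi_eq_of_mk0_eq (hp : IsPrimeTuple p) (h : IsQuadGen (disc p) s) {D : ℕ}
    (hD : D ∣ ∏ i : Fin n, p i.castSucc) {I J : (Ideal (𝓞 F))⁰}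
    (hIJ : ClassGroup.mk0 I = ClassGroup.mk0 J) : chi F p D I = chi F p D J := by
  rw [chi, chi, hilbertSymProd_eq_prod, hilbertSymProd_eq_prod]
  refine Finset.prod_congr rfl fun q hq => ?_
  obtain ⟨i, rfl⟩ := hp.exists_eq_of_prime_dvd hD (Nat.prime_of_mem_primeFactors hq)
    (Nat.dvd_of_mem_primeFactors hq)
  exact localSym_absNorm_eq_of_mk0_eq hp h _ hIJ

/-- For `b ∈ 𝔟` the element `(bD)²` lies in `𝔟²𝔞`, because `D ∈ 𝔞`. The unramified prime `q` then
divides `bD`, hence `b`. -/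
theorem le_span_of_sq_mul_le (h : IsQuadGen (disc p) s) {D q : ℕ} (hq : q.Prime)
    (hqΔ : ¬ (q : ℤ) ∣ disc p) (hqD : q.Coprime D) {𝔞 𝔟 : (Ideal (𝓞 F))⁰}
    (ha : IsRootIdeal F D 𝔞)
    (hle : (𝔟 : Ideal (𝓞 F)) ^ 2 * 𝔞 ≤ Ideal.span {(q : 𝓞 F)}) :
    (𝔟 : Ideal (𝓞 F)) ≤ Ideal.span {(q : 𝓞 F)} := by
  intro b hb
  rw [Ideal.mem_span_singleton]
  have hDa : (D : 𝓞 F) ∈ (𝔞 : Ideal (𝓞 F)) := by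
    have h1 : (D : 𝓞 F) ∈ (𝔞 : Ideal (𝓞 F)) ^ 2 := by
      rw [ha]
      exact Ideal.mem_span_singleton_self _
    exact Ideal.pow_le_self two_ne_zero h1
  have hmem : (b * D) ^ 2 ∈ (𝔟 : Ideal (𝓞 F)) ^ 2 * 𝔞 := by
    rw [mul_pow, pow_two (D : 𝓞 F), ← mul_assoc]
    exact Ideal.mul_mem_mul (Ideal.mul_mem_right _ _ (Ideal.pow_mem_pow hb 2)) hDa
  have hbD := h.dvd_of_dvd_sq hq hqΔ (Ideal.mem_span_singleton.mp (hle hmem))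
  obtain ⟨u, v, huv⟩ := Nat.isCoprime_iff_coprime.mpr hqD
  have huv' : (u : 𝓞 F) * q + v * D = 1 := by exact_mod_cast congrArg (Int.cast : ℤ → 𝓞 F) huv
  have hb' : b = q * (u * b) + v * (b * D) := by linear_combination -b * huv'
  rw [hb']
  exact dvd_add (dvd_mul_right _ _) (dvd_mul_of_dvd_right hbD _)

/-- The value of the character `χ_D` at a square root of the class of `D`. -/
theorem chi_eq_quarticSymProd (hp : IsPrimeTuple p) (h : IsQuadGen (disc p) s) {D : ℕ}
    (hD : D ∣ ∏ i : Fin n, p i.castSucc) {𝔞 I : (Ideal (𝓞 F))⁰} (ha : IsRootIdeal F D 𝔞)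
    (hI : ClassGroup.mk0 I ^ 2 = ClassGroup.mk0 𝔞) :
    chi F p D I = quarticSymProd (disc p / (D : ℤ)) D := by
  have hD4 := hp.mod_four_of_dvd hD
  have hDsq := hp.squarefree_of_dvd hD
  obtain ⟨e, he⟩ := natCast_dvd_disc hD
  have hD0 : (D : ℤ) ≠ 0 := by exact_mod_cast hDsq.ne_zero
  have he4 : e % 4 = 1 := by
    have h1 := hp.disc_mod_four
    rw [he, Int.mul_emod, show (D : ℤ) % 4 = 1 by omega] at h1
    omega
  have hm : 1 < 2 * (disc p).natAbs := by
    have := Int.natAbs_pos.mpr h.delta_ne_zero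
    omega
  obtain ⟨𝔟, hbI, hbm, hbprim⟩ := h.exists_primitive_coprime (ClassGroup.mk0 I) hm
  rw [chi_eq_of_mk0_eq hp h hD hbI.symm]
  set N := Ideal.absNorm (𝔟 : Ideal (𝓞 F)) with hN
  have hNodd : Odd N := Nat.coprime_two_right.mp (Nat.Coprime.coprime_mul_right_right hbm)
  have hNΔ : ∀ q : ℕ, q.Prime → (q : ℤ) ∣ disc p → ¬ q ∣ N := by
    intro q hq hqΔ hqN
    have h1 : q ∣ (disc p).natAbs := Int.natCast_dvd.mp hqΔ
    have h2 := Nat.dvd_gcd hqN (dvd_mul_of_dvd_right h1 2)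
    rw [hbm.gcd_eq_one, Nat.dvd_one] at h2
    exact hq.one_lt.ne' h2
  obtain ⟨β, hβ⟩ : ∃ β : 𝓞 F, (𝔟 : Ideal (𝓞 F)) ^ 2 * 𝔞 = Ideal.span {β} := by
    have h1 : ClassGroup.mk0 (𝔟 ^ 2 * 𝔞) = 1 := by
      have h2 : ClassGroup.mk0 (𝔞 ^ 2) = 1 := by
        rw [ClassGroup.mk0_eq_one_iff]
        exact ⟨⟨(D : 𝓞 F), ha⟩⟩
      rw [map_mul, map_pow, hbI, hI, ← pow_two, ← map_pow, h2]
    rw [ClassGroup.mk0_eq_one_iff] at h1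
    obtain ⟨⟨β, hβ⟩⟩ := h1
    exact ⟨β, hβ⟩
  obtain ⟨x, y, h2β, hnorm⟩ := h.coords β
  have hNβ : Algebra.norm ℤ β = (N : ℤ) ^ 2 * D := by
    rw [← h.absNorm_span, ← hβ, map_mul, map_pow, h.absNorm_of_isRootIdeal ha]
    push_cast
    rfl
  rw [hNβ, he] at hnorm
  obtain ⟨z, rfl⟩ : (D : ℤ) ∣ x := by
    have h1 : (D : ℤ) ∣ x ^ 2 := ⟨4 * N ^ 2 + e * y ^ 2, by linear_combination -hnorm⟩
    exact ((Int.squarefree_natCast.mpr hDsq).dvd_pow_iff_dvd two_ne_zero).mp h1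
  have heq : 4 * (N : ℤ) ^ 2 = D * z ^ 2 - e * y ^ 2 :=
    mul_left_cancel₀ hD0 (by linear_combination hnorm)
  have hzy : z % 2 = y % 2 := by
    have h1 := h.parity h2β
    rw [Int.mul_emod, show (D : ℤ) % 2 = 1 by omega] at h1
    omega
  -- A common odd prime `q` of `y` and `N` would divide `z`, hence `β`, hence every element of `𝔟`,
  -- contradicting primitivity.
  have hcop : ∀ q : ℕ, q.Prime → q ≠ 2 → (q : ℤ) ∣ y → ¬ q ∣ N := by
    intro q hq hq2 hqy hqN
    have hqΔ : ¬ (q : ℤ) ∣ disc p := fun hc => hNΔ q hq hc hqN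
    have hqD : ¬ (q : ℤ) ∣ D := fun hc => hqΔ (hc.trans ⟨e, he⟩)
    have hq' := Nat.prime_iff_prime_int.mp hq
    have hqN' : (q : ℤ) ∣ N := by exact_mod_cast hqN
    have hqz : (q : ℤ) ∣ D * z ^ 2 := by
      rw [show (D : ℤ) * z ^ 2 = 4 * N ^ 2 + e * y ^ 2 by rw [heq]; ring]
      exact dvd_add (dvd_mul_of_dvd_right (dvd_pow hqN' two_ne_zero) _)
        (dvd_mul_of_dvd_right (dvd_pow hqy two_ne_zero) _)
    have hqz' := hq'.dvd_of_dvd_pow ((hq'.dvd_or_dvd hqz).resolve_left hqD)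
    have hqβ := IsQuadGen.dvd_of_coords_dvd hq h2β (dvd_mul_of_dvd_right hqz' _) hqy hq2
    refine hbprim q hq (le_span_of_sq_mul_le h hq hqΔ
      ((Nat.Prime.coprime_iff_not_dvd hq).mpr (by exact_mod_cast hqD)) ha ?_)
    rw [hβ, Ideal.span_singleton_le_span_singleton]
    exact hqβ
  have hJ := jacobiSym_eq_one_of_eq hD4 he4 hNodd heq hzy hcop
  rw [he, Int.mul_ediv_cancel_left _ hD0]
  apply Units.ext
  have hchi : ((chi F p D 𝔟 : ℤˣ) : ℤ) = ∏ q ∈ D.primeFactors, jacobiSym N q := by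
    rw [chi, hilbertSymProd_eq_prod, Units.coe_prod]
    refine Finset.prod_congr rfl fun q hq => ?_
    have hqD := Nat.dvd_of_mem_primeFactors hq
    obtain ⟨i, rfl⟩ := hp.exists_eq_of_prime_dvd hD (Nat.prime_of_mem_primeFactors hq) hqD
    refine hp.localSym_eq_jacobiSym _ ?_
    have := hNΔ _ (hp.prime i.castSucc)
      (dvd_trans (by exact_mod_cast hqD) (natCast_dvd_disc hD))
    exact_mod_cast this
  have hquart : ((quarticSymProd e D : ℤˣ) : ℤ) =
      ∏ q ∈ D.primeFactors, jacobiSym N q * jacobiSym y q := by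
    rw [quarticSymProd, Units.coe_prod]
    refine Finset.prod_congr rfl fun q hq => ?_
    have hqD := Nat.dvd_of_mem_primeFactors hq
    have hqp := Nat.prime_of_mem_primeFactors hq
    have hqD' : (q : ℤ) ∣ D := by exact_mod_cast hqD
    obtain ⟨i, hi⟩ := hp.exists_eq_of_prime_dvd hD hqp hqD
    refine quarticSym_eq_of_dvd hqp (by rw [hi]; exact hp.one i) ?_
      (hNΔ q hqp (hqD'.trans ⟨e, he⟩))
    rw [heq, sub_add_cancel]
    exact dvd_mul_of_dvd_left hqD' _
  rw [hchi, hquart, Finset.prod_mul_distrib, ← jacobiSym_eq_prod_primeFactors y hDsq, hJ, mul_one]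

end Quartic

/-! ### The forms `𝔅` and `Q_𝔅` on the class group -/

theorem xi_mul (u v : ℤˣ) : xi (u * v) = xi u + xi v := by
  rcases Int.units_eq_one_or u with rfl | rfl <;> rcases Int.units_eq_one_or v with rfl | rfl <;>
    decide

theorem xi_surjective : Function.Surjective xi := by
  intro a
  have h01 : a = 0 ∨ a = 1 := by revert a; decide
  rcases h01 with rfl | rfl
  · exact ⟨1, by decide⟩
  · exact ⟨-1, by decide⟩

/-- The map `ξ` as a homomorphism. -/
def xiHom : Additive ℤˣ →+ ZMod 2 := AddMonoidHom.mk' (fun u => xi u.toMul) fun _ _ => xi_mul _ _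

theorem xi_prod {ι : Type*} (S : Finset ι) (f : ι → ℤˣ) : xi (∏ i ∈ S, f i) = ∑ i ∈ S, xi (f i) :=
  map_sum xiHom (fun i => Additive.ofMul (f i)) S

/-- The homomorphism `(Fin n → 𝔽₂) → A` sending the basis to given elements of order at most `2`. -/
def zmodTwoLift {A : Type*} [AddCommGroup A] {n : ℕ} (c : Fin n → A) (hc : ∀ i, 2 • c i = 0) :
    (Fin n → ZMod 2) →+ A :=
  ∑ i, (ZMod.lift 2 ⟨zmultiplesHom A (c i), (ofNat_zsmul (c i) 2).trans (hc i)⟩).comp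
    (Pi.evalAddMonoidHom (fun _ : Fin n => ZMod 2) i)

theorem zmodTwoLift_apply {A : Type*} [AddCommGroup A] {n : ℕ} (c : Fin n → A)
    (hc : ∀ i, 2 • c i = 0) (u : Fin n → ZMod 2) :
    zmodTwoLift c hc u = ∑ i with u i = 1, c i := by
  have h01 : ∀ a : ZMod 2, a = 0 ∨ a = 1 := by decide
  rw [zmodTwoLift, AddMonoidHom.finsetSum_apply, Finset.sum_filter]
  refine Finset.sum_congr rfl fun i _ => ?_
  simp only [AddMonoidHom.comp_apply, Pi.evalAddMonoidHom_apply]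
  rcases h01 (u i) with h | h
  · rw [h, map_zero, if_neg (by decide)]
  · rw [h, if_pos rfl]
    have := ZMod.lift_coe 2 ⟨zmultiplesHom A (c i), (ofNat_zsmul (c i) 2).trans (hc i)⟩ 1
    simpa using this

theorem dotProduct_eq_sum_filter {n : ℕ} (w u : Fin n → ZMod 2) :
    w ⬝ᵥ u = ∑ i with u i = 1, w i := by
  have h01 : ∀ a : ZMod 2, a = 0 ∨ a = 1 := by decide
  rw [dotProduct, Finset.sum_filter]
  refine Finset.sum_congr rfl fun i _ => ?_
  rcases h01 (u i) with h | h <;> simp [h]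

/-- The divisor of `p₁ ⋯ p_{t-1}` given by a vector over `𝔽₂`. -/
def divisorOf {n : ℕ} (p : Fin (n + 1) → ℕ) (u : Fin n → ZMod 2) : ℕ :=
  ∏ i with u i = 1, p i.castSucc

theorem divisorOf_dvd {n : ℕ} (p : Fin (n + 1) → ℕ) (u : Fin n → ZMod 2) :
    divisorOf p u ∣ ∏ i : Fin n, p i.castSucc :=
  Finset.prod_dvd_prod_of_subset _ _ _ (Finset.filter_subset _ _)

namespace IsPrimeTuple

variable {n : ℕ} {p : Fin (n + 1) → ℕ} (hp : IsPrimeTuple p)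
include hp

theorem primeFactors_divisorOf (u : Fin n → ZMod 2) :
    (divisorOf p u).primeFactors =
      (Finset.univ.filter fun i => u i = 1).image fun i => p i.castSucc := by
  have hinj : Set.InjOn (fun i : Fin n => p i.castSucc)
      (Finset.univ.filter fun i => u i = 1 : Finset (Fin n)) :=
    fun i _ j _ hij => Fin.castSucc_injective n (hp.inj hij)
  rw [divisorOf, ← Finset.prod_image (f := fun q => q) hinj]
  refine Nat.primeFactors_prod fun q hq => ?_
  obtain ⟨i, -, rfl⟩ := Finset.mem_image.mp hq
  exact hp.prime _

theorem prod_primeFactors_divisorOf {M : Type*} [CommMonoid M] (u : Fin n → ZMod 2) (f : ℕ → M) :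
    ∏ q ∈ (divisorOf p u).primeFactors, f q = ∏ i with u i = 1, f (p i.castSucc) := by
  rw [hp.primeFactors_divisorOf, Finset.prod_image]
  exact fun i _ j _ hij => Fin.castSucc_injective n (hp.inj hij)

theorem exists_divisorOf_eq {D : ℕ} (hD : D ∣ ∏ i : Fin n, p i.castSucc) :
    ∃ u, divisorOf p u = D := by
  classical
  refine ⟨fun i => if p i.castSucc ∣ D then 1 else 0, ?_⟩
  have hD0 := (hp.squarefree_of_dvd hD).ne_zero
  refine (Nat.prod_primeFactors_of_squarefree
    (hp.squarefree_of_dvd (divisorOf_dvd p _))).symm.trans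
    (Eq.trans ?_ (Nat.prod_primeFactors_of_squarefree (hp.squarefree_of_dvd hD)))
  congr 1
  rw [hp.primeFactors_divisorOf]
  ext q
  simp only [Finset.mem_image, Finset.mem_filter, Finset.mem_univ, true_and, Nat.mem_primeFactors]
  constructor
  · rintro ⟨i, hi, rfl⟩
    refine ⟨hp.prime _, ?_, hD0⟩
    by_contra hcon
    simp [hcon] at hi
  · rintro ⟨hq, hqD, -⟩
    obtain ⟨i, rfl⟩ := hp.exists_eq_of_prime_dvd hD hq hqD
    exact ⟨i, by simp [hqD], rfl⟩

end IsPrimeTuple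

/-! ### The maps `χ` and `ρ` on the class group, and the conclusion. -/

section ClassGroup

variable {F : Type*} [Field F] [NumberField F] {n : ℕ} {p : Fin (n + 1) → ℕ} {s : 𝓞 F}

theorem mk0_sq_of_isRootIdeal {D : ℕ} {𝔞 : (Ideal (𝓞 F))⁰} (ha : IsRootIdeal F D 𝔞) :
    ClassGroup.mk0 𝔞 ^ 2 = 1 := by
  rw [← map_pow, ClassGroup.mk0_eq_one_iff]
  exact ⟨⟨(D : 𝓞 F), ha⟩⟩

/-- All genus characters at the primes `≡ 1 (mod 4)`, with values in `𝔽₂`. -/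
def genusHom (hp : IsPrimeTuple p) (h : IsQuadGen (disc p) s) :
    Additive (ClassGroup (𝓞 F)) →+ (Fin n → ZMod 2) :=
  AddMonoidHom.mk' (fun c i => xi (genusChar hp h i.castSucc c.toMul)) fun c d => by
    ext i
    simp only [toMul_add, map_mul, xi_mul, Pi.add_apply]

theorem genusHom_apply (hp : IsPrimeTuple p) (h : IsQuadGen (disc p) s)
    (c : ClassGroup (𝓞 F)) (i : Fin n) :
    genusHom hp h (Additive.ofMul c) i = xi (genusChar hp h i.castSucc c) := rfl

theorem genusHom_surjective (hp : IsPrimeTuple p) (h : IsQuadGen (disc p) s) :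
    Function.Surjective (genusHom hp h) := by
  intro u
  choose ε hε using fun i => xi_surjective (u i)
  obtain ⟨c, hc⟩ := exists_genusChar_eq hp h ε
  refine ⟨Additive.ofMul c, funext fun i => ?_⟩
  rw [genusHom_apply, hc, hε]

theorem xi_chi_eq_dotProduct (hp : IsPrimeTuple p) (h : IsQuadGen (disc p) s)
    (u : Fin n → ZMod 2) (I : (Ideal (𝓞 F))⁰) :
    xi (chi F p (divisorOf p u) I) =
      genusHom hp h (Additive.ofMul (ClassGroup.mk0 I)) ⬝ᵥ u := by
  rw [chi, hilbertSymProd_eq_prod, hp.prod_primeFactors_divisorOf, xi_prod,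
    dotProduct_eq_sum_filter]
  refine Finset.sum_congr rfl fun i _ => ?_
  rw [genusHom_apply, genusChar_mk0]

/-- The homomorphism sending the divisor `∏ pᵢ` of `p₁ ⋯ p_{t-1}` to the class of `∏ 𝔭ᵢ`. -/
theorem exists_rootHom (hp : IsPrimeTuple p) (h : IsQuadGen (disc p) s) :
    ∃ ρ : (Fin n → ZMod 2) →+ Additive (ClassGroup (𝓞 F)),
      (∀ u, ∃ 𝔞 : (Ideal (𝓞 F))⁰, IsRootIdeal F (divisorOf p u) 𝔞 ∧
        ρ u = Additive.ofMul (ClassGroup.mk0 𝔞)) ∧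
      ∀ u v, genusHom hp h (ρ u) ⬝ᵥ v = genusHom hp h (ρ v) ⬝ᵥ u := by
  choose P hP using fun i : Fin n => h.exists_isRootIdeal (D := p i.castSucc)
    (natCast_dvd_disc (Finset.dvd_prod_of_mem (fun i : Fin n => p i.castSucc) (Finset.mem_univ i)))
  let c : Fin n → Additive (ClassGroup (𝓞 F)) := fun i => Additive.ofMul (ClassGroup.mk0 (P i))
  have hc : ∀ i, 2 • c i = 0 := fun i => mk0_sq_of_isRootIdeal (hP i)
  refine ⟨zmodTwoLift c hc, fun u => ⟨∏ i with u i = 1, P i, ?_, ?_⟩, fun u v => ?_⟩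
  · rw [IsRootIdeal, divisorOf, Submonoid.coe_finsetProd, ← Finset.prod_pow, Nat.cast_prod,
      ← Ideal.prod_span_singleton]
    exact Finset.prod_congr rfl fun i _ => hP i
  · rw [zmodTwoLift_apply, map_prod, ofMul_prod]
  · rw [dotProduct_eq_sum_filter, dotProduct_eq_sum_filter, zmodTwoLift_apply, zmodTwoLift_apply,
      map_sum, map_sum]
    simp only [Finset.sum_apply]
    rw [Finset.sum_comm]
    refine Finset.sum_congr rfl fun i _ => Finset.sum_congr rfl fun j _ => ?_
    rw [genusHom_apply, genusHom_apply, genusChar_isRootIdeal_symm hp h (hP i) (hP j)]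

theorem exists_divisorOf_isRootIdeal (hp : IsPrimeTuple p) (h : IsQuadGen (disc p) s)
    {c : ClassGroup (𝓞 F)} (hc : c ^ 2 = 1) :
    ∃ (u : Fin n → ZMod 2) (𝔞 : (Ideal (𝓞 F))⁰), IsRootIdeal F (divisorOf p u) 𝔞 ∧
      ClassGroup.mk0 𝔞 = c := by
  suffices hD : ∃ D : ℕ, D ∣ ∏ i : Fin n, p i.castSucc ∧ ∃ 𝔞 : (Ideal (𝓞 F))⁰,
      IsRootIdeal F D 𝔞 ∧ ClassGroup.mk0 𝔞 = c by
    obtain ⟨D, hD, 𝔞, h1, h2⟩ := hD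
    obtain ⟨u, rfl⟩ := hp.exists_divisorOf_eq hD
    exact ⟨u, 𝔞, h1, h2⟩
  obtain ⟨r, hr, K, hKc, hK⟩ := h.exists_dvd_isRootIdeal hc
  have hr' : r ∣ (∏ i : Fin n, p i.castSucc) * p (Fin.last n) := by
    rw [disc, dvd_neg, ← Nat.cast_prod, Int.natCast_dvd_natCast, Fin.prod_univ_castSucc] at hr
    exact hr
  have hl := hp.prime (Fin.last n)
  -- If the last prime divides `r`, replace `r` by `|Δ|/r`: the two root ideals multiply to `(√Δ)`,
  -- so their classes agree.
  by_cases hcop : r.Coprime (p (Fin.last n))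
  · exact ⟨r, hcop.dvd_of_dvd_mul_right hr', K, hK, hKc⟩
  · rw [Nat.coprime_comm, hl.coprime_iff_not_dvd, not_not] at hcop
    obtain ⟨r', rfl⟩ := hcop
    have hr'' : r' ∣ ∏ i : Fin n, p i.castSucc := by
      rw [mul_comm] at hr'
      exact Nat.dvd_of_mul_dvd_mul_right hl.pos hr'
    obtain ⟨D, hD⟩ := hr''
    have hDdvd : D ∣ ∏ i : Fin n, p i.castSucc := ⟨r', by rw [hD, mul_comm]⟩
    obtain ⟨𝔞, ha⟩ := h.exists_isRootIdeal (natCast_dvd_disc hDdvd)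
    refine ⟨D, hDdvd, 𝔞, ha, ?_⟩
    rw [← hKc]
    refine h.mk0_eq_of_mul_eq ?_ ha hK
    rw [disc, neg_neg, Fin.prod_univ_castSucc, ← Nat.cast_prod, hD]
    push_cast
    ring

theorem formQ_eq (hp : IsPrimeTuple p) (h : IsQuadGen (disc p) s) (D : V₀ F p) :
    formQ F p D = xi (quarticSymProd (disc p / ((D : ℕ) : ℤ)) D) := by
  obtain ⟨𝔞, ha, hb⟩ := (exists_sqrtIdeal F p D).choose_spec
  exact congrArg xi (chi_eq_quarticSymProd hp h D.2.1 ha hb)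

theorem twoPowRank_modEq_of_formQ_eq_zero (hp : IsPrimeTuple p) (h : IsQuadGen (disc p) s)
    (hQ : ∀ D : V₀ F p, formQ F p D = 0) :
    twoPowRank (ClassGroup (𝓞 F)) 3 (by norm_num) ≡
      twoPowRank (ClassGroup (𝓞 F)) 2 (by norm_num) [MOD 2] := by
  obtain ⟨ρ, hρ, hsymm⟩ := exists_rootHom hp h
  refine twoPowRank_three_modEq_two (genusHom hp h) (genusHom_surjective hp h) ρ ?_ hsymm ?_
  · intro a ha
    obtain ⟨u, 𝔞, h1, h2⟩ := exists_divisorOf_isRootIdeal hp h (c := a.toMul) ha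
    obtain ⟨𝔞', h1', h2'⟩ := hρ u
    refine ⟨u, ?_⟩
    have : 𝔞' = 𝔞 := Subtype.ext (ideal_eq_of_sq_eq (h1'.trans h1.symm))
    rw [h2', this, h2]
    rfl
  · intro u b hb
    obtain ⟨𝔞, h1, h2⟩ := hρ u
    obtain ⟨I, hI⟩ := ClassGroup.mk0_surjective b.toMul
    have hIsq : ClassGroup.mk0 I ^ 2 = ClassGroup.mk0 𝔞 := by
      rw [hI]
      exact Additive.ofMul.injective (hb.trans h2)
    have hdvd := divisorOf_dvd p u
    -- The form is defined with a chosen square root, whereas `b` is arbitrary here. The quartic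
    -- symbol does not depend on the root and links the two.
    have hQ' := hQ ⟨divisorOf p u, hdvd, 𝔞, h1, ClassGroup.mk0 I, hIsq⟩
    rw [formQ_eq hp h, ← chi_eq_quarticSymProd hp h hdvd h1 hIsq, xi_chi_eq_dotProduct hp h, hI]
      at hQ'
    exact hQ'

end ClassGroup

end EightRank

end

theorem mainTheorem4 {F : Type*} [Field F] [NumberField F] {n : ℕ} (p : Fin (n + 1) → ℕ)
    (hprime : ∀ i, (p i).Prime) (hinj : Function.Injective p)
    (hone : ∀ i : Fin n, p i.castSucc % 4 = 1) (hthree : p (Fin.last n) % 4 = 3)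
    (α : F) (hα : α ^ 2 = ((EightRank.disc p : ℤ) : F))
    (hgen : IntermediateField.adjoin ℚ {α} = ⊤) :
    (∀ D : EightRank.V₀ F p, EightRank.formQ F p D =
      EightRank.xi (EightRank.quarticSymProd (EightRank.disc p / ((D : ℕ) : ℤ)) D)) ∧
    ((∀ D : EightRank.V₀ F p, EightRank.formQ F p D = 0) →
      EightRank.twoPowRank (ClassGroup (𝓞 F)) 3 (by norm_num) ≡
        EightRank.twoPowRank (ClassGroup (𝓞 F)) 2 (by norm_num) [MOD 2]) := by
  have hp : EightRank.IsPrimeTuple p := ⟨hprime, hinj, hone, hthree⟩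
  obtain ⟨s, h⟩ := EightRank.exists_isQuadGen hp.disc_neg hp.disc_squarefree hp.disc_mod_four hα hgen
  exact ⟨EightRank.formQ_eq hp h, EightRank.twoPowRank_modEq_of_formQ_eq_zero hp h⟩
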